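/- **Theorem 1.4.** All graphs are finite and simple. A coloring of the edges of a graph $G$ with the colors red and blue is *critical* if $G$ contains neither a red copy of the 4-cycle $C_4$ nor a blue copy of the star $K_{1,k}$ (as a not necessarily induced subgraph). A graph $G$ is *$(C_4,K_{1,k})$-co-critical* if $G$ is not complete, $G$ admits a critical coloring, and $G+e$ admits no critical coloring for every edge $e$ of the complement of $G$. Let $e(G)$ be the number of edges of $G$, and let $$b(k,n)=\frac{(k+2)n}{2}-3-\frac{(k-1)\left(k+\lfloor\sqrt{k-2}\rfloor\right)}{2}.$$ 1. For all integers $k\ge 2$ and $n\ge k+\lfloor\sqrt{k-1}\rfloor+2$, every $(C_4,K_{1,k})$-co-critical graph $G$ on $n$ vertices satisfies $e(G)\ge b(k,n)$. 2. For $k\ge 3$ and $n\ge 3k+4$ this linear bound is asymptotically best possible: for every $k\ge3$ there is a constant $C$, depending only on $k$, such that for every $n\ge 3k+4$ there is a $(C_4,K_{1,k})$-co-critical graph $G$ on $n$ vertices with $e(G)\le b(k,n)+C$. 3. More precisely, let $k\ge 3$ and let $\varepsilon,\varepsilon^*\in\{0,1\}$ be the remainders of $n$ and $k$ modulo $2$,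 respectively. If $n\ge 3k+3+\varepsilon(2\varepsilon^*-1)$, then there is a $(C_4,K_{1,k})$-co-critical graph $G$ on $n$ vertices with $$e(G)=\begin{cases}\dfrac{(k+2)n}{2}-\dfrac{(2+\varepsilon)k-4\varepsilon}{2}&\text{if $k$ is odd},\\[2mm] \dfrac{(k+2)n}{2}-\dfrac{(2-\varepsilon)k-2(1-2\varepsilon)}{2}&\text{if $k$ is even}.\end{cases}$$ -/

import Mathlib

/-- The cycle `C₄`. -/
abbrev fourCycle : SimpleGraph (Fin 4) := SimpleGraph.cycleGraph 4

/-- The star `K_{1,k}`. -/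
abbrev starGraphK (k : ℕ) : SimpleGraph (Fin 1 ⊕ Fin k) := completeBipartiteGraph (Fin 1) (Fin k)

/-- The two colors. -/
inductive EdgeColor where
  | red
  | blue

/-- `τ` is a critical coloring of `G` for the pair `(H₁, H₂)`: the red color class contains no
copy of `H₁` and the blue color class contains no copy of `H₂` (as not necessarily induced
subgraphs). -/
def IsCriticalColoring {V W₁ W₂ : Type*} (H₁ : SimpleGraph W₁) (H₂ : SimpleGraph W₂)
    {G : SimpleGraph V} (τ : G.EdgeLabeling EdgeColor) : Prop :=
  H₁.Free (τ.labelGraph EdgeColor.red) ∧ H₂.Free (τ.labelGraph EdgeColor.blue)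

/-- `G` admits a critical coloring for `(H₁, H₂)`, that is, `G ↛ (H₁, H₂)`. -/
def HasCriticalColoring {V W₁ W₂ : Type*} (H₁ : SimpleGraph W₁) (H₂ : SimpleGraph W₂)
    (G : SimpleGraph V) : Prop :=
  ∃ τ : G.EdgeLabeling EdgeColor, IsCriticalColoring H₁ H₂ τ

/-- `G` is `(H₁, H₂)`-co-critical: it is not complete, it admits a critical coloring, and `G + e`
admits none for every edge `e` of the complement of `G`. -/
def IsCoCritical {V W₁ W₂ : Type*} (H₁ : SimpleGraph W₁) (H₂ : SimpleGraph W₂)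
    (G : SimpleGraph V) : Prop :=
  G ≠ ⊤ ∧ HasCriticalColoring H₁ H₂ G ∧
    ∀ u v : V, Gᶜ.Adj u v → ¬ HasCriticalColoring H₁ H₂ (G ⊔ SimpleGraph.edge u v)

/-- The lower bound `(k+2)n/2 - 3 - (k-1)(k + ⌊√(k-2)⌋)/2`, for `k ≥ 2`
(`Nat.sqrt` is the floor of the square root). -/
noncomputable def edgeLowerBound (k n : ℕ) : ℝ :=
  ((k : ℝ) + 2) * n / 2 - 3 - ((k : ℝ) - 1) * ((k : ℝ) + Nat.sqrt (k - 2)) / 2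

/-! Lower bound. Among all critical colorings take one whose red graph R is maximal under inclusion.
Then R has no four-cycle, and any two vertices nonadjacent in R are joined by a red path with three
edges: otherwise the pair could be coloured red, either recolouring a blue edge, against maximality,
or adding an edge to G, against co-criticality (`exists_saturated_critical`). Such an R satisfies
2e(R) ≥ 3n - 6 (`three_mul_card_le_sum_degIn`), shown by splitting on the minimum degree; only
degrees one and two need work. Vertices of blue degree below k - 1 form a clique of G, since a
missing edge could be added in blue; this bounds the total amount by which blue degrees fall short
of k - 1 (`sum_deficit_le`). Adding the red and blue degree sums gives the bound.

Upper bound. Two adjacent hubs dominate the graph and have 2k - 1 common neighbours. In any critical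
coloring each hub has at most k - 1 blue edges and at most one common neighbour is red to both, so
the count is tight: every other edge at a hub is red, and each remaining vertex has red degree at
most two, hence total degree at most k + 1. Regular vertices already have degree k + 1, so no edge
can be added (`isCoCritical_of_hubs`). The explicit graph is `hubRed ⊔ hubBlue`: red triangles
hanging from the hubs, and a nearly circulant blue graph between the two regular classes. A few
special vertices adjust the parity of n. The asymptotic statement follows from the exact edge
counts. -/

/-! ### Critical colorings in terms of the red graph; degree counts -/

section Basics

open Finset
open scoped Classical

variable {V : Type*}

/-- Two distinct vertices have at most one common neighbour. -/
def FourCycleFree (R : SimpleGraph V) : Prop :=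
  ∀ ⦃a b c d : V⦄, R.Adj a b → R.Adj c b → R.Adj a d → R.Adj c d → a ≠ c → b = d

/-- The number of neighbours of `v` inside `T`. -/
noncomputable def degIn (R : SimpleGraph V) (T : Finset V) (v : V) : ℕ := #{w ∈ T | R.Adj v w}

theorem fourCycle_free_iff {R : SimpleGraph V} : fourCycle.Free R ↔ FourCycleFree R := by
  constructor
  · intro h a b c d hab hcb had hcd hac
    by_contra hbd
    refine h ⟨⟨⟨![a, b, c, d], ?_⟩, ?_⟩⟩
    · intro i j hij
      have : (i - j = 1 ∨ j - i = 1) := SimpleGraph.cycleGraph_adj.1 hij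
      fin_cases i <;> fin_cases j <;> first
        | (exfalso; revert this; decide)
        | simp [hab, hcb, had, hcd, hab.symm, hcb.symm, had.symm, hcd.symm]
    · intro i j hij
      have h1 := hab.ne
      have h2 := hcb.ne
      have h3 := had.ne
      have h4 := hcd.ne
      fin_cases i <;> fin_cases j <;> simp_all
  · rintro h ⟨f⟩
    have hadj : ∀ i j : Fin 4, (i - j = 1 ∨ j - i = 1) → R.Adj (f i) (f j) :=
      fun i j hij => f.toHom.map_adj (SimpleGraph.cycleGraph_adj.2 hij)
    have := h (hadj 0 1 (by decide)) (hadj 2 1 (by decide)) (hadj 0 3 (by decide))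
      (hadj 2 3 (by decide)) (fun e => absurd (f.injective e) (by decide))
    exact absurd (f.injective this) (by decide)

theorem star_free_iff [Fintype V] {k : ℕ} {B : SimpleGraph V} :
    (starGraphK k).Free B ↔ ∀ v, degIn B univ v < k := by
  constructor
  · intro h v
    by_contra! hk
    obtain ⟨t, ht, htk⟩ := exists_subset_card_eq hk
    let e : Fin k ≃ t := (Fintype.equivFinOfCardEq (by simpa using htk)).symm
    have he : ∀ i, B.Adj v (e i) := fun i => (mem_filter.1 (ht (e i).2)).2
    refine h ⟨⟨⟨Sum.elim (fun _ => v) (fun i => (e i : V)), ?_⟩, ?_⟩⟩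
    · rintro (i | i) (j | j) hij
      · simp at hij
      · exact he j
      · exact (he i).symm
      · simp at hij
    · rintro (i | i) (j | j) hij
      · exact congrArg _ (Subsingleton.elim _ _)
      · exact absurd hij (he j).ne
      · exact absurd hij (he i).ne'
      · exact congrArg _ (e.injective (Subtype.ext hij))
  · rintro h ⟨f⟩
    refine (h (f (Sum.inl 0))).not_ge ?_
    have : (univ.map ⟨fun i : Fin k => f (Sum.inr i), fun i j hij =>
        Sum.inr_injective (f.injective hij)⟩) ⊆ univ.filter (B.Adj (f (Sum.inl 0))) := by
      intro x hx
      obtain ⟨i, -, rfl⟩ := mem_map.1 hx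
      refine mem_filter.2 ⟨mem_univ _, f.toHom.map_adj ?_⟩
      simp
    simpa [degIn] using card_le_card this

/-- A coloring is the same as its red graph R; the blue graph is then `G \ R`. -/
theorem hasCriticalColoring_iff [Fintype V] {k : ℕ} {G : SimpleGraph V} :
    HasCriticalColoring fourCycle (starGraphK k) G ↔
      ∃ R ≤ G, FourCycleFree R ∧ ∀ v, degIn (G \ R) univ v < k := by
  constructor
  · rintro ⟨τ, h1, h2⟩
    refine ⟨τ.labelGraph .red, τ.labelGraph_le, fourCycle_free_iff.1 h1, ?_⟩
    convert star_free_iff.1 h2 using 3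
    ext x y
    simp only [SimpleGraph.sdiff_adj, SimpleGraph.EdgeLabeling.labelGraph_adj, not_exists]
    constructor
    · rintro ⟨h, h'⟩
      refine ⟨h, ?_⟩
      cases hc : τ ⟨s(x, y), h⟩
      · exact absurd hc (h' h)
      · rfl
    · rintro ⟨h, h'⟩
      exact ⟨h, fun _ h'' => by rw [h'] at h''; cases h''⟩
  · rintro ⟨R, hR, h1, h2⟩
    let τ : G.EdgeLabeling EdgeColor := fun e => if e.1 ∈ R.edgeSet then .red else .blue
    refine ⟨τ, fourCycle_free_iff.2 ?_, star_free_iff.2 ?_⟩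
    · convert h1
      ext x y
      rw [SimpleGraph.EdgeLabeling.labelGraph_adj]
      simp only [τ, SimpleGraph.mem_edgeSet]
      constructor
      · rintro ⟨h, h'⟩
        by_contra hn
        simp [hn] at h'
      · intro h
        exact ⟨hR h, by simp [h]⟩
    · convert h2 using 3
      ext x y
      rw [SimpleGraph.EdgeLabeling.labelGraph_adj]
      simp only [τ, SimpleGraph.mem_edgeSet, SimpleGraph.sdiff_adj]
      constructor
      · rintro ⟨h, h'⟩
        refine ⟨h, fun hn => ?_⟩
        simp [hn] at h'
      · rintro ⟨h, h'⟩
        exact ⟨h, by simp [h']⟩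

theorem degIn_eq_sum (R : SimpleGraph V) (T : Finset V) (v : V) :
    degIn R T v = ∑ w ∈ T, if R.Adj v w then 1 else 0 := by
  simp [degIn]

theorem sum_degIn_comm (R : SimpleGraph V) (S T : Finset V) :
    ∑ v ∈ S, degIn R T v = ∑ w ∈ T, degIn R S w := by
  simp only [degIn_eq_sum]
  rw [sum_comm]
  simp only [R.adj_comm]

theorem degIn_mono {R : SimpleGraph V} {S T : Finset V} (h : S ⊆ T) (v : V) :
    degIn R S v ≤ degIn R T v :=
  card_le_card (filter_subset_filter _ h)

theorem degIn_mono_graph {R R' : SimpleGraph V} (h : R ≤ R') (T : Finset V) (v : V) :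
    degIn R T v ≤ degIn R' T v :=
  card_le_card (monotone_filter_right _ fun _ _ ha => h ha)

theorem degIn_pos_iff {R : SimpleGraph V} {T : Finset V} {v : V} :
    0 < degIn R T v ↔ ∃ w ∈ T, R.Adj v w := by
  simp [degIn, card_pos, Finset.Nonempty]

theorem degIn_add_sdiff {R G : SimpleGraph V} (h : R ≤ G) (T : Finset V) (v : V) :
    degIn R T v + degIn (G \ R) T v = degIn G T v := by
  simp only [degIn_eq_sum, ← sum_add_distrib]
  refine sum_congr rfl fun w _ => ?_
  by_cases h1 : R.Adj v w
  · simp [h1, h h1]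
  · simp [h1]

theorem sum_degIn_univ [Fintype V] (G : SimpleGraph V) :
    ∑ v, degIn G univ v = 2 * G.edgeSet.ncard := by
  rw [Set.ncard_eq_toFinset_card', ← SimpleGraph.edgeFinset, ← G.sum_degrees_eq_twice_card_edges]
  refine sum_congr rfl fun v _ => ?_
  rw [degIn, ← SimpleGraph.card_neighborFinset_eq_degree]
  congr 1
  ext w
  simp

/-- In a graph without four-cycles, two distinct vertices have at most one common neighbour. -/
theorem FourCycleFree.degIn_inter_le_one {R : SimpleGraph V} (h : FourCycleFree R) {a c : V}
    (hac : a ≠ c) (T : Finset V) (hT : ∀ w ∈ T, R.Adj a w) : degIn R T c ≤ 1 := by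
  rw [degIn, card_le_one]
  intro x hx y hy
  rw [mem_filter] at hx hy
  exact h (hT x hx.1) hx.2 (hT y hy.1) hy.2 hac

end Basics

/-! ### Saturated four-cycle-free graphs: a vertex of degree one -/

section Saturation

open Finset
open scoped Classical

variable {V : Type*}

/-- Any two distinct nonadjacent vertices are joined by a path with three edges. -/
def PathSaturated (R : SimpleGraph V) : Prop :=
  ∀ ⦃u v : V⦄, u ≠ v → ¬ R.Adj u v → ∃ a b, R.Adj u a ∧ R.Adj a b ∧ R.Adj b v

variable [Fintype V] {R : SimpleGraph V}

theorem sum_split_two (f : V → ℕ) {u v : V} (huv : u ≠ v) {N W : Finset V}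
    (hN : ∀ w, w ∈ N ↔ w ≠ u ∧ w ≠ v ∧ w ∉ W) (hu : u ∉ W) (hv : v ∉ W) :
    ∑ w, f w = f u + f v + ∑ w ∈ N, f w + ∑ w ∈ W, f w := by
  have hd : Disjoint N W := disjoint_left.2 fun w hw => ((hN w).1 hw).2.2
  have hd' : Disjoint {u, v} (N ∪ W) := by
    simp [disjoint_left, hN, hu, hv]
  have : (univ : Finset V) = {u, v} ∪ (N ∪ W) := by
    ext w
    simp only [mem_univ, mem_union, mem_insert, mem_singleton, hN, true_iff]
    tauto
  rw [this, sum_union hd', sum_union hd, sum_pair huv, ← add_assoc]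

theorem sum_split_three (f : V → ℕ) {a b v : V} (hab : a ≠ b) (hav : a ≠ v) (hbv : b ≠ v)
    {S W : Finset V} (hS : ∀ w, w ∈ S ↔ w ≠ a ∧ w ≠ b ∧ w ≠ v ∧ w ∉ W) (ha : a ∉ W) (hb : b ∉ W)
    (hv : v ∉ W) :
    ∑ w, f w = f v + f a + f b + ∑ w ∈ S, f w + ∑ w ∈ W, f w := by
  have hd : Disjoint S W := disjoint_left.2 fun w hw => ((hS w).1 hw).2.2.2
  have hd' : Disjoint {a, b} (S ∪ W) := by
    simp [disjoint_left, hS, ha, hb]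
  have hd'' : Disjoint {v} ({a, b} ∪ (S ∪ W)) := by
    simp [hS, hv, hav.symm, hbv.symm]
  have : (univ : Finset V) = {v} ∪ ({a, b} ∪ (S ∪ W)) := by
    ext w
    simp only [mem_univ, mem_union, mem_insert, mem_singleton, hS, true_iff]
    tauto
  rw [this, sum_union hd'', sum_union hd', sum_union hd, sum_pair hab, sum_singleton]
  ring

/-- A three-edge path between two leaves must use both pendant edges, so the attachment vertices in
N of three leaves are pairwise adjacent. Together with u they contain a four-cycle. -/
theorem card_leaves_le_two (hR : FourCycleFree R) (hsat : PathSaturated R) {u : V} {N L : Finset V}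
    (hN : ∀ w ∈ N, R.Adj u w) (hL : ∀ w ∈ L, w ∉ N ∧ degIn R univ w ≤ 1 ∧ ∃ b ∈ N, R.Adj w b) :
    #L ≤ 2 := by
  by_contra! h
  obtain ⟨w₁, h1, w₂, h2, w₃, h3, h12, h13, h23⟩ := two_lt_card.1 h
  have key : ∀ w ∈ L, ∃ b ∈ N, ∀ x, R.Adj w x ↔ x = b := by
    intro w hw
    obtain ⟨-, hd, b, hb, hwb⟩ := hL w hw
    refine ⟨b, hb, fun x => ⟨fun hx => ?_, fun hx => hx ▸ hwb⟩⟩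
    exact card_le_one.1 hd x (by simpa using hx) b (by simpa using hwb)
  obtain ⟨b₁, hb1, e1⟩ := key w₁ h1
  obtain ⟨b₂, hb2, e2⟩ := key w₂ h2
  obtain ⟨b₃, hb3, e3⟩ := key w₃ h3
  have step : ∀ {w w' b b'}, w ∈ L → w' ∈ L → w ≠ w' → b ∈ N → (∀ x, R.Adj w x ↔ x = b) →
      (∀ x, R.Adj w' x ↔ x = b') → R.Adj b b' := by
    intro w w' b b' _ hw' hne hb e e'
    obtain ⟨p, q, hp, hpq, hq⟩ := hsat hne (fun hadj => (hL w' hw').1 ((e w').1 hadj ▸ hb))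
    rw [(e p).1 hp, (e' q).1 hq.symm] at hpq
    exact hpq
  have h₁₂ := step h1 h2 h12 hb1 e1 e2
  have h₁₃ := step h1 h3 h13 hb1 e1 e3
  have h₂₃ := step h2 h3 h23 hb2 e2 e3
  exact h₂₃.ne (hR (hN b₂ hb2) h₁₂ (hN b₃ hb3) h₁₃ (hN b₁ hb1).ne)

/-- Three-edge paths from v start with v, u, so every vertex other than u and v has a neighbour in
N. Hence vertices of N have degree at least two plus their degree into W, and the edges between N
and W number at least |W|. At most two vertices of W are leaves, so the degree sum is at least 2 +
3|N| + 3|W| - 2 = 3(n - 2). -/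
theorem three_mul_card_le_of_leaf (hR : FourCycleFree R) (hsat : PathSaturated R) {u v : V}
    (hv : ∀ w, R.Adj v w ↔ w = u) :
    3 * Fintype.card V ≤ ∑ w, degIn R univ w + 6 := by
  have hvu : R.Adj v u := (hv u).2 rfl
  set N : Finset V := {w | R.Adj u w ∧ w ≠ v} with hNdef
  set W : Finset V := {w | w ≠ u ∧ w ≠ v ∧ ¬ R.Adj u w} with hWdef
  have hN : ∀ w, w ∈ N ↔ w ≠ u ∧ w ≠ v ∧ w ∉ W := by
    intro w
    have : R.Adj u w → w ≠ u := fun h => h.ne'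
    simp only [hNdef, hWdef, mem_filter, mem_univ, true_and]
    tauto
  have hsplit := fun f : V → ℕ => sum_split_two f hvu.ne' hN (by simp [W]) (by simp [W])
  have hcover : ∀ w, w ≠ u → w ≠ v → ∃ b ∈ N, R.Adj w b := by
    intro w hwu hwv
    obtain ⟨p, b, hp, hpb, hbw⟩ := hsat hwv.symm (fun h => hwu ((hv w).1 h))
    obtain rfl := (hv p).1 hp
    refine ⟨b, ?_, hbw.symm⟩
    simp only [N, mem_filter, mem_univ, true_and]
    exact ⟨hpb, fun hb => hwu ((hv w).1 (hb ▸ hbw))⟩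
  have hcard : Fintype.card V = 1 + 1 + #N + #W := by
    have := hsplit fun _ => 1
    simpa using this
  have hdeg : ∀ x, degIn R univ x =
      (if R.Adj x u then 1 else 0) + (if R.Adj x v then 1 else 0) + degIn R N x + degIn R W x := by
    intro x
    simp only [degIn_eq_sum]
    exact hsplit _
  have hdu : 1 + #N ≤ degIn R univ u := by
    have : degIn R N u = #N := by
      rw [degIn, filter_true_of_mem]
      intro w hw
      exact (mem_filter.1 hw).2.1
    rw [hdeg u, this, if_pos hvu.symm]
    omega
  have hdv : 1 ≤ degIn R univ v := degIn_pos_iff.2 ⟨u, mem_univ _, hvu⟩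
  have hdN : ∀ b ∈ N, 2 + degIn R W b ≤ degIn R univ b := by
    intro b hb
    have h1 := (mem_filter.1 hb).2
    have h2 : 0 < degIn R N b := degIn_pos_iff.2 (hcover b h1.1.ne' h1.2)
    rw [hdeg b, if_pos h1.1.symm]
    omega
  set L : Finset V := {w ∈ W | degIn R univ w ≤ 1} with hLdef
  have hW : ∀ w ∈ W, ∃ b ∈ N, R.Adj w b := fun w hw =>
    hcover w (mem_filter.1 hw).2.1 (mem_filter.1 hw).2.2.1
  have hL2 : #L ≤ 2 := by
    refine card_leaves_le_two hR hsat (u := u) (N := N) (fun w hw => (mem_filter.1 hw).2.1) ?_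
    intro w hw
    obtain ⟨hw, hd⟩ := mem_filter.1 hw
    exact ⟨fun h => ((hN w).1 h).2.2 hw, hd, hW w hw⟩
  have hdW : ∀ w ∈ W, 2 ≤ degIn R univ w + if degIn R univ w ≤ 1 then 1 else 0 := by
    intro w hw
    obtain ⟨b, -, hb⟩ := hW w hw
    have : 0 < degIn R univ w := degIn_pos_iff.2 ⟨b, mem_univ _, hb⟩
    split_ifs <;> omega
  have s1 := sum_le_sum hdN
  have s2 := sum_le_sum hdW
  have s3 : #W ≤ ∑ w ∈ W, degIn R N w := by
    rw [card_eq_sum_ones]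
    exact sum_le_sum fun w hw => degIn_pos_iff.2 (hW w hw)
  have s4 : ∑ w ∈ W, (if degIn R univ w ≤ 1 then 1 else 0) = #L := by
    simp [L]
  rw [sum_add_distrib, sum_degIn_comm] at s1
  rw [sum_add_distrib, s4] at s2
  simp only [sum_const, smul_eq_mul] at s1 s2
  rw [hsplit, hcard]
  omega

end Saturation

/-! ### A vertex v of degree two; the case of nonadjacent neighbours a, b -/

section SaturationDegreeTwo

open Finset
open scoped Classical

variable {V : Type*} {R : SimpleGraph V}

/-- Two edges `w w'`, `u u'` whose ends have degree two, with outer neighbours `s₁, s₂` and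
`t₁, t₂`, violate saturation under mild distinctness assumptions. -/
theorem PathSaturated.false_of_links (hsat : PathSaturated R) {T : Finset V}
    {s₁ s₂ t₁ t₂ w w' u u' : V} (hs₁ : s₁ ∈ T) (hs₂ : s₂ ∈ T) (ht₁ : t₁ ∈ T)
    (hw : w ∉ T) (hw' : w' ∉ T) (hu : u ∉ T) (hu' : u' ∉ T)
    (nw : ∀ x, R.Adj w x ↔ x = s₁ ∨ x = w') (nw' : ∀ x, R.Adj w' x ↔ x = s₂ ∨ x = w)
    (nu : ∀ x, R.Adj u x ↔ x = t₁ ∨ x = u') (nu' : ∀ x, R.Adj u' x ↔ x = t₂ ∨ x = u)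
    (hs : s₁ ≠ s₂) (h11 : s₁ ≠ t₁) (h12 : s₁ ≠ t₂) (h21 : s₂ ≠ t₁) (hadj : ¬ R.Adj s₁ t₁) :
    False := by
  have ne : ∀ {x y : V}, x ∈ T → y ∉ T → x ≠ y := fun hx hy h => hy (h ▸ hx)
  have hwt : ¬ R.Adj w t₁ := fun h => ((nw _).1 h).elim h11.symm (ne ht₁ hw')
  have hw't : ¬ R.Adj w' t₁ := fun h => ((nw' _).1 h).elim h21.symm (ne ht₁ hw)
  have hu's : ¬ R.Adj u' s₁ := fun h => ((nu' _).1 h).elim h12 (ne hs₁ hu)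
  have hwu : w ≠ u := fun h => hwt (h ▸ (nu _).2 (Or.inl rfl))
  have hw'u : w' ≠ u := fun h => hw't (h ▸ (nu _).2 (Or.inl rfl))
  have hu'w : u' ≠ w := fun h => hu's (h ▸ (nw _).2 (Or.inl rfl))
  obtain ⟨p, q, hp, hpq, hq⟩ := hsat hwu (fun h => ((nw _).1 h).elim (ne hs₁ hu).symm hw'u.symm)
  -- The middle edge of a path from w to u joins {s₁, w'} to {t₁, u'}; each of the four pairs is
  -- nonadjacent.
  rcases (nw _).1 hp with rfl | rfl <;> rcases (nu _).1 hq.symm with rfl | rfl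
  · exact hadj hpq
  · exact hu's hpq.symm
  · exact hw't hpq
  · exact ((nw' _).1 hpq).elim (ne hs₂ hu').symm hu'w

variable [Fintype V]

/-- The vertices other than `a`, `b`, `v` with a neighbour among `a`, `b`. -/
noncomputable def sideVertices (R : SimpleGraph V) (a b v : V) : Finset V :=
  {w | w ≠ a ∧ w ≠ b ∧ w ≠ v ∧ (R.Adj a w ∨ R.Adj b w)}

/-- The vertices other than `a`, `b`, `v` without a neighbour among `a`, `b`. -/
noncomputable def farVertices (R : SimpleGraph V) (a b v : V) : Finset V :=
  {w | w ≠ a ∧ w ≠ b ∧ w ≠ v ∧ ¬ R.Adj a w ∧ ¬ R.Adj b w}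

theorem mem_sideVertices {a b v w : V} :
    w ∈ sideVertices R a b v ↔ w ≠ a ∧ w ≠ b ∧ w ≠ v ∧ (R.Adj a w ∨ R.Adj b w) := by
  simp [sideVertices]

theorem mem_farVertices {a b v w : V} :
    w ∈ farVertices R a b v ↔ w ≠ a ∧ w ≠ b ∧ w ≠ v ∧ ¬ R.Adj a w ∧ ¬ R.Adj b w := by
  simp [farVertices]

theorem sum_eq_side_far (f : V → ℕ) {a b v : V} (hab : a ≠ b) (hav : a ≠ v) (hbv : b ≠ v) :
    ∑ w, f w = f v + f a + f b + ∑ w ∈ sideVertices R a b v, f w +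
      ∑ w ∈ farVertices R a b v, f w := by
  refine sum_split_three f hab hav hbv (fun w => ?_) ?_ ?_ ?_
  · rw [mem_sideVertices, mem_farVertices]; tauto
  all_goals simp [mem_farVertices]

theorem card_eq_side_far {a b v : V} (hab : a ≠ b) (hav : a ≠ v) (hbv : b ≠ v) :
    Fintype.card V = 3 + #(sideVertices R a b v) + #(farVertices R a b v) := by
  have := sum_eq_side_far (R := R) (fun _ => 1) hab hav hbv
  simpa using this

theorem degIn_univ_eq_side_far {a b v : V} (hab : a ≠ b) (hav : a ≠ v) (hbv : b ≠ v) (x : V) :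
    degIn R univ x = (if R.Adj x v then 1 else 0) + (if R.Adj x a then 1 else 0) +
      (if R.Adj x b then 1 else 0) + degIn R (sideVertices R a b v) x +
        degIn R (farVertices R a b v) x := by
  simp only [degIn_eq_sum]
  exact sum_eq_side_far _ hab hav hbv

theorem exists_side_of_far (hsat : PathSaturated R) {a b v w : V}
    (hv : ∀ w, R.Adj v w ↔ w = a ∨ w = b) (hw : w ∈ farVertices R a b v) :
    ∃ s ∈ sideVertices R a b v, R.Adj w s := by
  obtain ⟨hwa, hwb, hwv, hna, hnb⟩ := mem_farVertices.1 hw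
  obtain ⟨p, s, hp, hps, hsw⟩ := hsat hwv.symm (fun h => by
    rcases (hv w).1 h with h | h <;> contradiction)
  refine ⟨s, mem_sideVertices.2 ⟨?_, ?_, ?_, ?_⟩, hsw.symm⟩
  · rintro rfl; exact hna hsw
  · rintro rfl; exact hnb hsw
  · rintro rfl
    rcases (hv w).1 hsw with h | h <;> contradiction
  · rcases (hv p).1 hp with rfl | rfl
    · exact Or.inl hps
    · exact Or.inr hps

theorem degIn_far {a b v w : V} (hab : a ≠ b) (hav : a ≠ v) (hbv : b ≠ v)
    (hv : ∀ w, R.Adj v w ↔ w = a ∨ w = b) (hw : w ∈ farVertices R a b v) :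
    degIn R univ w = degIn R (sideVertices R a b v) w + degIn R (farVertices R a b v) w := by
  obtain ⟨hwa, hwb, hwv, hna, hnb⟩ := mem_farVertices.1 hw
  rw [degIn_univ_eq_side_far hab hav hbv, if_neg (mt SimpleGraph.Adj.symm hna),
    if_neg (mt SimpleGraph.Adj.symm hnb), if_neg]
  · omega
  · intro h
    rcases (hv w).1 h.symm with h | h <;> contradiction

/-- Edges between side and far vertices are charged to the far end, whence the factor two there. The
term twice the number of side vertices counts both ends of one edge from each of them to {a, b}. -/
theorem le_sum_degIn_of_degree_two {a b v : V} (hab : a ≠ b)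
    (hv : ∀ w, R.Adj v w ↔ w = a ∨ w = b) :
    4 + (if R.Adj a b then 2 else 0) + 2 * #(sideVertices R a b v) +
        ∑ s ∈ sideVertices R a b v, degIn R (sideVertices R a b v) s +
        ∑ w ∈ farVertices R a b v, (2 * degIn R (sideVertices R a b v) w +
          degIn R (farVertices R a b v) w) ≤ ∑ w, degIn R univ w := by
  have hva : R.Adj v a := (hv a).2 (Or.inl rfl)
  have hvb : R.Adj v b := (hv b).2 (Or.inr rfl)
  have hdeg := degIn_univ_eq_side_far (R := R) hab hva.ne' hvb.ne'
  rw [sum_eq_side_far (R := R) _ hab hva.ne' hvb.ne']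
  have hS : ∀ s ∈ sideVertices R a b v, 1 + degIn R (sideVertices R a b v) s +
      degIn R (farVertices R a b v) s ≤ degIn R univ s := by
    intro s hs
    rw [hdeg s]
    rcases (mem_sideVertices.1 hs).2.2.2 with h | h
    · rw [if_pos h.symm]; omega
    · rw [if_pos h.symm]; omega
  have hW : ∀ w ∈ farVertices R a b v, degIn R (sideVertices R a b v) w +
      degIn R (farVertices R a b v) w = degIn R univ w := fun w hw =>
    (degIn_far hab hva.ne' hvb.ne' hv hw).symm
  have h1 := sum_le_sum hS
  have h2 : ∑ w ∈ farVertices R a b v, (degIn R (sideVertices R a b v) w +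
      degIn R (farVertices R a b v) w) = ∑ w ∈ farVertices R a b v, degIn R univ w :=
    sum_congr rfl hW
  have h3 : #(sideVertices R a b v) ≤
      degIn R (sideVertices R a b v) a + degIn R (sideVertices R a b v) b := by
    rw [degIn_eq_sum, degIn_eq_sum, ← sum_add_distrib, card_eq_sum_ones]
    refine sum_le_sum fun s hs => ?_
    rcases (mem_sideVertices.1 hs).2.2.2 with h | h
    · rw [if_pos h]; omega
    · rw [if_pos h]; omega
  have h4 := hdeg v
  have h5 := hdeg a
  have h6 := hdeg b
  rw [if_pos hva, if_pos hvb] at h4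
  rw [if_pos hva.symm] at h5
  rw [if_pos hvb.symm] at h6
  have h7 := sum_degIn_comm R (farVertices R a b v) (sideVertices R a b v)
  simp only [sum_add_distrib, sum_const, smul_eq_mul, ← mul_sum] at h1 h2 ⊢
  by_cases hab' : R.Adj a b
  · simp only [hab', hab'.symm, if_true] at h5 h6 ⊢
    omega
  · simp only [hab', if_false]
    omega

/-- As a and b are nonadjacent, the path from v to a side vertex s enters s through another side
vertex. Thus each side vertex contributes at least 3 to the preceding bound, and so does each far
vertex. -/
theorem three_mul_card_le_of_not_adj (hsat : PathSaturated R) {a b v : V} (hab : a ≠ b)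
    (hv : ∀ w, R.Adj v w ↔ w = a ∨ w = b) (hdeg : ∀ w, 2 ≤ degIn R univ w) (hnab : ¬ R.Adj a b) :
    3 * Fintype.card V ≤ ∑ w, degIn R univ w + 6 := by
  have hva : R.Adj v a := (hv a).2 (Or.inl rfl)
  have hvb : R.Adj v b := (hv b).2 (Or.inr rfl)
  have hmain := le_sum_degIn_of_degree_two hab hv
  have hS : ∀ s ∈ sideVertices R a b v, 1 ≤ degIn R (sideVertices R a b v) s := by
    intro s hs
    obtain ⟨hsa, hsb, hsv, hs'⟩ := mem_sideVertices.1 hs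
    have hsv' : ¬ R.Adj v s := fun h => by
      rcases (hv s).1 h with h | h <;> contradiction
    obtain ⟨p, t, hp, hpt, hts⟩ := hsat hsv.symm hsv'
    refine degIn_pos_iff.2 ⟨t, mem_sideVertices.2 ?_, hts.symm⟩
    have htv : t ≠ v := fun h => hsv' (h ▸ hts)
    rcases (hv p).1 hp with rfl | rfl
    · exact ⟨hpt.ne', fun h => hnab (h ▸ hpt), htv, Or.inl hpt⟩
    · exact ⟨fun h => hnab (h ▸ hpt).symm, hpt.ne', htv, Or.inr hpt⟩
  have hW : ∀ w ∈ farVertices R a b v, 3 ≤ 2 * degIn R (sideVertices R a b v) w +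
      degIn R (farVertices R a b v) w := by
    intro w hw
    have h1 := degIn_pos_iff.2 (exists_side_of_far hsat hv hw)
    have h2 := degIn_far hab hva.ne' hvb.ne' hv hw
    have h3 := hdeg w
    omega
  have h1 := sum_le_sum hS
  have h2 := sum_le_sum hW
  rw [if_neg hnab] at hmain
  simp only [sum_const, smul_eq_mul] at h1 h2
  rw [card_eq_side_far (R := R) hab hva.ne' hvb.ne']
  omega

end SaturationDegreeTwo

/-! ### A vertex of degree two with adjacent neighbours: discharging -/

section SaturationTriangle

open Finset
open scoped Classical

variable {V : Type*} {R : SimpleGraph V}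

theorem not_adj_both (hR : FourCycleFree R) {a b v s : V} (hab : a ≠ b)
    (hv : ∀ w, R.Adj v w ↔ w = a ∨ w = b) (hs : s ≠ v) (ha : R.Adj a s) : ¬ R.Adj b s := fun hb =>
  hs (hR ha hb ((hv a).2 (Or.inl rfl)).symm ((hv b).2 (Or.inr rfl)).symm hab)

variable [Fintype V]

theorem sideVertices_swap (a b v : V) : sideVertices R a b v = sideVertices R b a v := by
  ext; simp only [mem_sideVertices]; tauto

theorem farVertices_swap (a b v : V) : farVertices R a b v = farVertices R b a v := by
  ext; simp only [mem_farVertices]; tauto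

theorem mem_side_or_far {a b v x : V} (ha : x ≠ a) (hb : x ≠ b) (hv : x ≠ v) :
    x ∈ sideVertices R a b v ∨ x ∈ farVertices R a b v := by
  rw [mem_sideVertices, mem_farVertices]; tauto

/-- A vertex `s` of `S` without neighbours in `S` all of whose neighbours in `W` contribute as
little as possible to the degree sum. -/
def IsDeficient (R : SimpleGraph V) (S W : Finset V) (s : V) : Prop :=
  (∀ t ∈ S, ¬ R.Adj s t) ∧ ∀ w ∈ W, R.Adj s w →
    (degIn R S w = 1 ∧ degIn R W w = 1) ∨ (degIn R S w = 2 ∧ degIn R W w = 0)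

/-- Apart from a, all neighbours of s and s' are far. The three-edge path between them cannot pass
through a, so both inner vertices are far, and deficiency leaves them no other neighbours. -/
theorem exists_link (hR : FourCycleFree R) (hsat : PathSaturated R) {a b v s s' : V} (hab : a ≠ b)
    (hv : ∀ w, R.Adj v w ↔ w = a ∨ w = b)
    (hs : s ∈ sideVertices R a b v) (hs' : s' ∈ sideVertices R a b v)
    (hd : IsDeficient R (sideVertices R a b v) (farVertices R a b v) s)
    (hd' : IsDeficient R (sideVertices R a b v) (farVertices R a b v) s')
    (has : R.Adj a s) (has' : R.Adj a s') (hne : s ≠ s') :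
    ∃ w w', w ∉ sideVertices R a b v ∧ w' ∉ sideVertices R a b v ∧
      (∀ x, R.Adj w x ↔ x = s ∨ x = w') ∧ (∀ x, R.Adj w' x ↔ x = s' ∨ x = w) := by
  have hnS : ∀ t ∈ sideVertices R a b v, R.Adj a t →
      IsDeficient R (sideVertices R a b v) (farVertices R a b v) t → ∀ x, R.Adj t x →
        x = a ∨ x ∈ farVertices R a b v := by
    intro t ht hat htd x hx
    obtain ⟨hta, htb, htv, -⟩ := mem_sideVertices.1 ht
    by_contra! hcon
    have hxv : x ≠ v := by
      rintro rfl
      rcases (hv t).1 hx.symm with h | h <;> contradiction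
    have hxb : x ≠ b := by
      rintro rfl
      exact not_adj_both hR hab hv htv hat hx.symm
    rcases mem_side_or_far (R := R) hcon.1 hxb hxv with h | h
    · exact htd.1 x h hx
    · exact hcon.2 h
  have hnW : ∀ w ∈ farVertices R a b v, ∀ x, R.Adj w x →
      x ∈ sideVertices R a b v ∨ x ∈ farVertices R a b v := by
    intro w hw x hx
    obtain ⟨hwa, hwb, hwv, hna, hnb⟩ := mem_farVertices.1 hw
    refine mem_side_or_far ?_ ?_ ?_
    · rintro rfl; exact hna hx.symm
    · rintro rfl; exact hnb hx.symm
    · rintro rfl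
      rcases (hv w).1 hx.symm with h | h <;> contradiction
  have hnbr : ∀ t ∈ sideVertices R a b v,
      IsDeficient R (sideVertices R a b v) (farVertices R a b v) t →
      ∀ p ∈ farVertices R a b v, ∀ q ∈ farVertices R a b v, R.Adj t p → R.Adj p q →
        ∀ x, R.Adj p x ↔ x = t ∨ x = q := by
    intro t ht htd p hp q hq htp hpq x
    have hWp : 0 < degIn R (farVertices R a b v) p := degIn_pos_iff.2 ⟨q, hq, hpq⟩
    rcases htd.2 p hp htp with ⟨h1, h2⟩ | ⟨-, h2⟩
    · constructor
      · intro hx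
        rcases hnW p hp x hx with h | h
        · exact Or.inl (card_le_one.1 h1.le x (by simp [h, hx]) t (by simp [ht, htp.symm]))
        · exact Or.inr (card_le_one.1 h2.le x (by simp [h, hx]) q (by simp [hq, hpq]))
      · rintro (rfl | rfl)
        · exact htp.symm
        · exact hpq
    · omega
  have hfar : ∀ w ∈ farVertices R a b v, w ∉ sideVertices R a b v := fun w hw hw' =>
    (mem_sideVertices.1 hw').2.2.2.elim (mem_farVertices.1 hw).2.2.2.1 (mem_farVertices.1 hw).2.2.2.2
  obtain ⟨p, q, hp, hpq, hq⟩ := hsat hne (hd.1 s' hs')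
  have hqW : q ≠ a → q ∈ farVertices R a b v := fun h =>
    (hnS s' hs' has' hd' q hq.symm).resolve_left h
  rcases hnS s hs has hd p hp with rfl | hpW
  · exact absurd hpq (mem_farVertices.1 (hqW hpq.ne')).2.2.2.1
  · rcases eq_or_ne q a with rfl | hqa
    · exact absurd hpq.symm (mem_farVertices.1 hpW).2.2.2.1
    · exact ⟨p, q, hfar p hpW, hfar q (hqW hqa), hnbr s hs hd p hpW q (hqW hqa) hp hpq,
        hnbr s' hs' hd' q (hqW hqa) p hpW hq.symm hpq.symm⟩

/-- Three such vertices would give links s₁s₂ and s₃s₂, contradicting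
`PathSaturated.false_of_links`. -/
theorem card_deficient_side_le_two (hR : FourCycleFree R) (hsat : PathSaturated R) {a b v : V}
    (hab : a ≠ b) (hv : ∀ w, R.Adj v w ↔ w = a ∨ w = b) :
    #{s ∈ sideVertices R a b v | IsDeficient R (sideVertices R a b v) (farVertices R a b v) s ∧
      R.Adj a s} ≤ 2 := by
  by_contra! h
  obtain ⟨s₁, h1, s₂, h2, s₃, h3, h12, h13, h23⟩ := two_lt_card.1 h
  simp only [mem_filter] at h1 h2 h3
  obtain ⟨w, w', hw, hw', nw, nw'⟩ :=
    exists_link hR hsat hab hv h1.1 h2.1 h1.2.1 h2.2.1 h1.2.2 h2.2.2 h12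
  obtain ⟨u, u', hu, hu', nu, nu'⟩ :=
    exists_link hR hsat hab hv h3.1 h2.1 h3.2.1 h2.2.1 h3.2.2 h2.2.2 h23.symm
  exact hsat.false_of_links h1.1 h2.1 h3.1 hw hw' hu hu' nw nw' nu nu' h12 h13 h12 h23
    (h1.2.1.1 s₃ h3.1)

/-- Each of a, b has at most two deficient neighbours. Two at both would yield one link on either
side, and these are again incompatible. -/
theorem card_deficient_le_three (hR : FourCycleFree R) (hsat : PathSaturated R) {a b v : V}
    (hab : a ≠ b) (hv : ∀ w, R.Adj v w ↔ w = a ∨ w = b) :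
    #{s ∈ sideVertices R a b v |
      IsDeficient R (sideVertices R a b v) (farVertices R a b v) s} ≤ 3 := by
  have hA := card_deficient_side_le_two hR hsat hab hv
  have hB := card_deficient_side_le_two hR hsat hab.symm (fun w => (hv w).trans or_comm)
  rw [← sideVertices_swap a b, ← farVertices_swap a b] at hB
  have hle : #{s ∈ sideVertices R a b v |
      IsDeficient R (sideVertices R a b v) (farVertices R a b v) s} ≤
      #{s ∈ sideVertices R a b v | IsDeficient R (sideVertices R a b v) (farVertices R a b v) s ∧
        R.Adj a s} +
      #{s ∈ sideVertices R a b v | IsDeficient R (sideVertices R a b v) (farVertices R a b v) s ∧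
        R.Adj b s} := by
    refine (card_le_card fun s hs => ?_).trans (card_union_le _ _)
    obtain ⟨hs, hd⟩ := mem_filter.1 hs
    have := (mem_sideVertices.1 hs).2.2.2
    simp only [mem_union, mem_filter]
    tauto
  by_contra! h
  obtain ⟨s₁, h1, s₂, h2, h12⟩ := one_lt_card.1 (show 1 < #{s ∈ sideVertices R a b v |
    IsDeficient R (sideVertices R a b v) (farVertices R a b v) s ∧ R.Adj a s} by omega)
  obtain ⟨t₁, h3, t₂, h4, h34⟩ := one_lt_card.1 (show 1 < #{s ∈ sideVertices R a b v |
    IsDeficient R (sideVertices R a b v) (farVertices R a b v) s ∧ R.Adj b s} by omega)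
  simp only [mem_filter] at h1 h2 h3 h4
  obtain ⟨w, w', hw, hw', nw, nw'⟩ :=
    exists_link hR hsat hab hv h1.1 h2.1 h1.2.1 h2.2.1 h1.2.2 h2.2.2 h12
  have hlink := exists_link hR hsat (s := t₁) (s' := t₂) hab.symm (fun w => (hv w).trans or_comm)
  rw [← sideVertices_swap a b, ← farVertices_swap a b] at hlink
  obtain ⟨u, u', hu, hu', nu, nu'⟩ := hlink h3.1 h4.1 h3.2.1 h4.2.1 h3.2.2 h4.2.2 h34
  have hne : ∀ {s t}, s ∈ sideVertices R a b v → R.Adj a s → R.Adj b t → s ≠ t := by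
    rintro s t hs has hbt rfl
    exact not_adj_both hR hab hv (mem_sideVertices.1 hs).2.2.1 has hbt
  exact hsat.false_of_links h1.1 h2.1 h3.1 hw hw' hu hu' nw nw' nu nu' h12
    (hne h1.1 h1.2.2 h3.2.2) (hne h1.1 h1.2.2 h4.2.2) (hne h2.1 h2.2.2 h3.2.2) (h1.2.1.1 t₁ h3.1)

/-- In the bound of `le_sum_degIn_of_degree_two` every far vertex is worth at least 3, and hands its
excess to its one or two neighbours in S. Only deficient side vertices then stay below 3, by at most
one each; the edge ab compensates for three of them. -/
theorem three_mul_card_le_of_adj (hR : FourCycleFree R) (hsat : PathSaturated R) {a b v : V}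
    (hab : R.Adj a b) (hv : ∀ w, R.Adj v w ↔ w = a ∨ w = b)
    (hdeg : ∀ w, 2 ≤ degIn R univ w) :
    3 * Fintype.card V ≤ ∑ w, degIn R univ w + 6 := by
  have hva : R.Adj v a := (hv a).2 (Or.inl rfl)
  have hvb : R.Adj v b := (hv b).2 (Or.inr rfl)
  have hmain := le_sum_degIn_of_degree_two hab.ne hv
  rw [if_pos hab] at hmain
  have hdef := card_deficient_le_three hR hsat hab.ne hv
  rw [card_eq_side_far (R := R) hab.ne hva.ne' hvb.ne']
  have hdS : ∀ w ∈ farVertices R a b v, 1 ≤ degIn R (sideVertices R a b v) w ∧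
      degIn R (sideVertices R a b v) w ≤ 2 ∧
      2 ≤ degIn R (sideVertices R a b v) w + degIn R (farVertices R a b v) w := by
    intro w hw
    have h1 := degIn_pos_iff.2 (exists_side_of_far hsat hv hw)
    have h2 := degIn_far hab.ne hva.ne' hvb.ne' hv hw
    refine ⟨h1, ?_, h2 ▸ hdeg w⟩
    have hw' := mem_farVertices.1 hw
    have ha := hR.degIn_inter_le_one hw'.1.symm ({s ∈ sideVertices R a b v | R.Adj a s})
      (fun x hx => (mem_filter.1 hx).2)
    have hb := hR.degIn_inter_le_one hw'.2.1.symm ({s ∈ sideVertices R a b v | R.Adj b s})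
      (fun x hx => (mem_filter.1 hx).2)
    have : degIn R (sideVertices R a b v) w ≤
        degIn R ({s ∈ sideVertices R a b v | R.Adj a s}) w +
          degIn R ({s ∈ sideVertices R a b v | R.Adj b s}) w := by
      refine (card_le_card fun s hs => ?_).trans (card_union_le _ _)
      obtain ⟨hs, hd⟩ := mem_filter.1 hs
      have := (mem_sideVertices.1 hs).2.2.2
      simp only [mem_union, mem_filter]
      tauto
    omega
  generalize hS : sideVertices R a b v = S at *
  generalize hW : farVertices R a b v = W at *
  -- Twice the excess 2 d_S(w) + d_W(w) - 3, shared equally among the d_S(w) neighbours in S;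
  -- doubling avoids halves.
  let g : V → ℕ := fun w => if degIn R S w = 1 then 2 * (degIn R W w - 1) else degIn R W w + 1
  have hcharge : ∀ s ∈ S, 2 ≤ 2 * degIn R S s + (∑ w ∈ W, if R.Adj s w then g w else 0) +
      2 * (if IsDeficient R S W s then 1 else 0) := by
    intro s hs
    by_cases hd : IsDeficient R S W s
    · rw [if_pos hd]; omega
    · rw [IsDeficient, not_and_or] at hd
      rcases hd with hd | hd
      · push Not at hd
        have := degIn_pos_iff.2 hd
        omega
      · push Not at hd
        obtain ⟨w, hw, hsw, h1, h2⟩ := hd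
        have hle := single_le_sum (f := fun w => if R.Adj s w then g w else 0)
          (fun _ _ => Nat.zero_le _) hw
        have hg : 2 ≤ g w := by
          obtain ⟨h3, h4, h5⟩ := hdS w hw
          simp only [g]
          split_ifs <;> omega
        simp only [if_pos hsw] at hle
        omega
  have hsum := sum_le_sum hcharge
  have hg : ∑ s ∈ S, ∑ w ∈ W, (if R.Adj s w then g w else 0) + 6 * #W =
      ∑ w ∈ W, 2 * (2 * degIn R S w + degIn R W w) := by
    rw [sum_comm]
    have : 6 * #W = ∑ w ∈ W, 6 := by simp [mul_comm]
    rw [this, ← sum_add_distrib]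
    refine sum_congr rfl fun w hw => ?_
    have : ∑ s ∈ S, (if R.Adj s w then g w else 0) = degIn R S w * g w := by
      rw [degIn_eq_sum, sum_mul]
      refine sum_congr rfl fun s _ => ?_
      simp [R.adj_comm]
    rw [this]
    obtain ⟨h3, h4, h5⟩ := hdS w hw
    simp only [g]
    split_ifs with h6
    · rw [h6]; omega
    · have : degIn R S w = 2 := by omega
      rw [this]; ring
  simp only [sum_add_distrib, sum_const, smul_eq_mul, ← mul_sum] at hsum hg hmain
  rw [sum_boole] at hsum
  simp only [Nat.cast_id] at hsum
  omega

/-- A `C₄`-saturated graph on `n` vertices has at least `(3 n - 6) / 2` edges. -/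
theorem three_mul_card_le_sum_degIn (hR : FourCycleFree R) (hsat : PathSaturated R) :
    3 * Fintype.card V ≤ ∑ w, degIn R univ w + 6 := by
  by_cases h3 : ∀ w, 3 ≤ degIn R univ w
  · have := sum_le_sum (s := univ) fun w _ => h3 w
    simp only [sum_const, smul_eq_mul, card_univ] at this
    omega
  push Not at h3
  obtain ⟨v₀, hv₀⟩ := h3
  obtain ⟨v, -, hmin⟩ := exists_min_image univ (degIn R univ) ⟨v₀, mem_univ _⟩
  have hv3 : degIn R univ v < 3 := (hmin v₀ (mem_univ _)).trans_lt hv₀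
  have hmem : ∀ w, w ∈ univ.filter (R.Adj v) ↔ R.Adj v w := by simp
  interval_cases hd : degIn R univ v
  · have hiso : ∀ w, ¬ R.Adj v w := by
      intro w hw
      rw [degIn, card_eq_zero] at hd
      exact notMem_empty w (hd ▸ (hmem w).2 hw)
    have : Fintype.card V ≤ 1 := by
      refine Fintype.card_le_one_iff.2 fun x y => ?_
      have : ∀ x, x = v := by
        intro x
        by_contra hx
        obtain ⟨p, -, hp, -⟩ := hsat (Ne.symm hx) (hiso x)
        exact hiso p hp
      rw [this x, this y]
    omega
  · rw [degIn, card_eq_one] at hd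
    obtain ⟨u, hu⟩ := hd
    exact three_mul_card_le_of_leaf hR hsat (u := u) (v := v) fun w => by
      rw [← hmem, hu, mem_singleton]
  · rw [degIn, card_eq_two] at hd
    obtain ⟨a, b, hab, hu⟩ := hd
    have hv : ∀ w, R.Adj v w ↔ w = a ∨ w = b := fun w => by
      rw [← hmem, hu, mem_insert, mem_singleton]
    have hdeg : ∀ w, 2 ≤ degIn R univ w := fun w => hmin w (mem_univ _)
    by_cases hadj : R.Adj a b
    · exact three_mul_card_le_of_adj hR hsat hadj hv hdeg
    · exact three_mul_card_le_of_not_adj hsat hab hv hdeg hadj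

end SaturationTriangle

/-! ### The lower bound -/

section LowerBound

open Finset
open scoped Classical

variable {V : Type*}

/-- A four-cycle created by uv uses that edge, and its other three edges form the path. -/
theorem exists_path_of_add_edge {R : SimpleGraph V} (hR : FourCycleFree R) {u v : V}
    (hadd : ¬ FourCycleFree (R ⊔ SimpleGraph.edge u v)) :
    ∃ a b, R.Adj u a ∧ R.Adj a b ∧ R.Adj b v := by
  by_contra! hno
  have hsym := R.adj_comm
  have hloop : ∀ x, ¬ R.Adj x x := fun x => R.irrefl
  refine hadd fun a b c d hab hcb had hcd hac => ?_
  by_contra hbd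
  have hfree := @hR a b c d
  simp only [SimpleGraph.sup_adj, SimpleGraph.edge_adj] at hab hcb had hcd
  rcases hab with hab | ⟨⟨rfl, rfl⟩ | ⟨rfl, rfl⟩, hab⟩
  · rcases hcb with hcb | ⟨⟨rfl, rfl⟩ | ⟨rfl, rfl⟩, hcb⟩
    · rcases had with had | ⟨⟨rfl, rfl⟩ | ⟨rfl, rfl⟩, had⟩ <;> grind
    · grind
    · grind
  · grind
  · grind

/-- Counting paths with two edges in a graph without four-cycles. -/
theorem FourCycleFree.sum_degIn_mul_le {R : SimpleGraph V} (hR : FourCycleFree R) (A : Finset V) :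
    ∑ v ∈ A, degIn R A v * degIn R A v ≤ ∑ v ∈ A, degIn R A v + #A * (#A - 1) := by
  -- Both sides count walks u, v, w in A, by the middle vertex and by the ends. Closed walks u = w
  -- give the degree sum; each pair of distinct ends has at most one middle vertex.
  have h1 : ∑ v ∈ A, degIn R A v * degIn R A v =
      ∑ u ∈ A, ∑ w ∈ A, degIn R (A.filter (R.Adj u)) w := by
    simp_rw [fun u => sum_degIn_comm R A (A.filter (R.Adj u)), sum_filter]
    rw [sum_comm]
    refine sum_congr rfl fun v _ => ?_
    conv_lhs => rw [degIn_eq_sum, sum_mul]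
    refine sum_congr rfl fun u _ => ?_
    simp [R.adj_comm, degIn_eq_sum]
  rw [h1]
  have h2 : ∀ u ∈ A, ∑ w ∈ A, degIn R (A.filter (R.Adj u)) w ≤ degIn R A u + (#A - 1) := by
    intro u hu
    rw [← add_sum_erase _ _ hu, ← card_erase_of_mem hu, card_eq_sum_ones]
    refine add_le_add ?_ (sum_le_sum fun w hw => ?_)
    · exact card_le_card (filter_subset_filter _ (filter_subset _ _))
    · exact hR.degIn_inter_le_one (ne_of_mem_erase hw).symm _ fun x hx => (mem_filter.1 hx).2
  refine (sum_le_sum h2).trans ?_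
  rw [sum_add_distrib, sum_const, smul_eq_mul]

variable [Fintype V]

theorem exists_saturated_critical {k : ℕ} {G : SimpleGraph V}
    (hG : IsCoCritical fourCycle (starGraphK k) G) :
    ∃ R ≤ G, FourCycleFree R ∧ (∀ v, degIn (G \ R) univ v < k) ∧ PathSaturated R := by
  obtain ⟨-, hcrit, hco⟩ := hG
  let F : Set (SimpleGraph V) := {R | R ≤ G ∧ FourCycleFree R ∧ ∀ v, degIn (G \ R) univ v < k}
  have hne : F.Nonempty := hasCriticalColoring_iff.1 hcrit
  obtain ⟨R, hmax⟩ := (Set.toFinite F).exists_maximal hne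
  obtain ⟨hRG, hfree, hdeg⟩ := hmax.prop
  refine ⟨R, hRG, hfree, hdeg, fun u v huv hnadj => exists_path_of_add_edge hfree fun hf => ?_⟩
  have hdeg' : ∀ w, degIn ((G ⊔ SimpleGraph.edge u v) \ (R ⊔ SimpleGraph.edge u v)) univ w < k := by
    intro w
    refine (degIn_mono_graph ?_ _ _).trans_lt (hdeg w)
    intro x y
    simp only [SimpleGraph.sdiff_adj, SimpleGraph.sup_adj]
    tauto
  by_cases hadj : G.Adj u v
  · have hle : SimpleGraph.edge u v ≤ G := by
      rw [SimpleGraph.edge_le_iff]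
      exact Or.inr hadj
    rw [sup_eq_left.2 hle] at hdeg'
    have := hmax.le_of_ge (y := R ⊔ SimpleGraph.edge u v) ⟨sup_le hRG hle, hf, hdeg'⟩ le_sup_left
    refine hnadj (this ?_)
    simp [SimpleGraph.edge_adj, huv]
  · exact hco u v (by simp [huv, hadj])
      (hasCriticalColoring_iff.2 ⟨_, sup_le_sup_right hRG _, hf, hdeg'⟩)

theorem adj_of_small_blue_degree {k : ℕ} {G R : SimpleGraph V}
    (hG : IsCoCritical fourCycle (starGraphK k) G) (hRG : R ≤ G) (hR : FourCycleFree R)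
    (hdeg : ∀ v, degIn (G \ R) univ v < k) {u v : V} (huv : u ≠ v)
    (hu : degIn (G \ R) univ u + 1 < k) (hv : degIn (G \ R) univ v + 1 < k) : G.Adj u v := by
  by_contra hadj
  refine hG.2.2 u v (by simp [huv, hadj]) (hasCriticalColoring_iff.2
    ⟨R, hRG.trans le_sup_left, hR, fun w => ?_⟩)
  have hle : degIn ((G ⊔ SimpleGraph.edge u v) \ R) univ w ≤
      degIn (G \ R) univ w + degIn (SimpleGraph.edge u v) univ w := by
    simp only [degIn_eq_sum, ← sum_add_distrib]
    refine sum_le_sum fun x _ => ?_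
    simp only [SimpleGraph.sdiff_adj, SimpleGraph.sup_adj]
    split_ifs <;> first | omega | tauto
  have hone : degIn (SimpleGraph.edge u v) univ w ≤ 1 := by
    rw [degIn, card_le_one]
    intro x hx y hy
    simp only [mem_filter, mem_univ, true_and, SimpleGraph.edge_adj] at hx hy
    grind
  have hzero : w ≠ u → w ≠ v → degIn (SimpleGraph.edge u v) univ w = 0 := by
    intro hwu hwv
    refine Nat.eq_zero_of_not_pos fun h => ?_
    obtain ⟨x, -, hx⟩ := degIn_pos_iff.1 h
    simp only [SimpleGraph.edge_adj] at hx
    tauto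
  have := hdeg w
  rcases eq_or_ne w u with rfl | hwu
  · omega
  rcases eq_or_ne w v with rfl | hwv
  · omega
  have := hzero hwu hwv
  omega

/-- Let s = ⌊√(k-2)⌋. If |A| ≤ k + s, each deficit is at most k - 1. Otherwise |A| = k + q with q ≥
s + 1. A vertex of deficit x then has at least q + x red neighbours inside the clique A, and
counting red two-edge paths gives total deficit at most |A|. As all deficits are positive, the same
count also gives q² ≤ k - 1, so q = s + 1; this is the second term of the maximum. -/
theorem sum_deficit_le {k : ℕ} (hk : 2 ≤ k) {G R : SimpleGraph V} (hRG : R ≤ G)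
    (hR : FourCycleFree R) {A : Finset V} (hA : ∀ v ∈ A, degIn (G \ R) univ v + 1 < k)
    (hclique : ∀ u ∈ A, ∀ v ∈ A, u ≠ v → G.Adj u v) :
    ∑ v ∈ A, (k - 1 - degIn (G \ R) univ v) ≤
      max ((k - 1) * (k + Nat.sqrt (k - 2))) (k + Nat.sqrt (k - 2) + 1) := by
  rcases le_or_gt (#A) (k + Nat.sqrt (k - 2)) with hm | hm
  · refine le_max_of_le_left ?_
    calc _ ≤ ∑ v ∈ A, (k - 1) := sum_le_sum fun v _ => Nat.sub_le _ _
      _ = (k - 1) * #A := by simp [mul_comm]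
      _ ≤ _ := Nat.mul_le_mul_left _ hm
  · refine le_max_of_le_right ?_
    set s := Nat.sqrt (k - 2) with hs
    have hsq : k - 2 < (s + 1) * (s + 1) := Nat.lt_succ_sqrt _
    obtain ⟨q, hq⟩ : ∃ q, #A = k + q := ⟨#A - k, by omega⟩
    have hqs : s + 1 ≤ q := by omega
    have hkq : k ≤ q * q + 1 := by
      have := Nat.mul_le_mul hqs hqs
      omega
    have hr : ∀ v ∈ A, q + (k - 1 - degIn (G \ R) univ v) ≤ degIn R A v := by
      intro v hv
      have h1 := degIn_add_sdiff hRG A v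
      have h2 : degIn G A v = #A - 1 := by
        rw [degIn, ← card_erase_of_mem hv]
        congr 1
        ext w
        simp only [mem_filter, mem_erase]
        exact ⟨fun h => ⟨h.2.ne', h.1⟩, fun h => ⟨h.2, hclique v hv w h.2 h.1.symm⟩⟩
      have h3 := degIn_mono (R := G \ R) (subset_univ A) v
      have := hA v hv
      omega
    -- With red degree r ≥ q + x and x ≥ 1 this is r(r - 1) ≥ q(q + 1) + x - 1, written without
    -- subtraction.
    have hterm : ∀ v ∈ A, q * q + q + (k - 1 - degIn (G \ R) univ v) + degIn R A v ≤
        degIn R A v * degIn R A v + 1 := by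
      intro v hv
      have h1 := hr v hv
      have h2 : 1 ≤ k - 1 - degIn (G \ R) univ v := by
        have := hA v hv
        omega
      generalize k - 1 - degIn (G \ R) univ v = x at *
      generalize degIn R A v = r at *
      obtain ⟨y, rfl⟩ := Nat.exists_eq_add_of_le h1
      obtain ⟨z, rfl⟩ := Nat.exists_eq_add_of_le h2
      nlinarith [Nat.zero_le (y * y), Nat.zero_le (y * z), Nat.zero_le (z * z),
        Nat.zero_le (y * q), Nat.zero_le (q * z), Nat.mul_le_mul_right z (show 1 ≤ q by omega)]
    have hsum := sum_le_sum hterm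
    have hpath := hR.sum_degIn_mul_le A
    simp only [sum_add_distrib, sum_const, smul_eq_mul, mul_one] at hsum
    have hge : #A ≤ ∑ v ∈ A, (k - 1 - degIn (G \ R) univ v) := by
      rw [card_eq_sum_ones]
      refine sum_le_sum fun v hv => ?_
      have := hA v hv
      omega
    have hle : #A * (#A - 1) ≤ #A * (q * q + q) := Nat.mul_le_mul_left _ (by omega)
    have hmul : #A * (q * q + q) = #A * (q * q) + #A * q := mul_add _ _ _
    have hD : ∑ v ∈ A, (k - 1 - degIn (G \ R) univ v) ≤ #A := by omega
    have hqk : q * q + q ≤ #A - 1 := by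
      refine Nat.le_of_mul_le_mul_left (c := #A) ?_ (by omega)
      omega
    have hqs' : q ≤ s + 1 := by
      by_contra! hcon
      obtain ⟨t, rfl⟩ := Nat.exists_eq_add_of_lt hcon
      nlinarith [Nat.zero_le (t * t), Nat.zero_le (t * s), show k ≥ 2 from hk, hsq, hqk,
        show (s+1+t+1)*(s+1+t+1) + 1 ≤ k by omega, show k ≤ (s+1)*(s+1) + 1 by omega]
    omega

theorem edgeLowerBound_le {k : ℕ} (hk : 2 ≤ k) {G : SimpleGraph V}
    (hG : IsCoCritical fourCycle (starGraphK k) G) :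
    edgeLowerBound k (Fintype.card V) ≤ (G.edgeSet.ncard : ℝ) := by
  obtain ⟨R, hRG, hR, hdeg, hsat⟩ := exists_saturated_critical hG
  have hred := three_mul_card_le_sum_degIn hR hsat
  have hdef := sum_deficit_le hk hRG hR
    (A := univ.filter fun v => degIn (G \ R) univ v + 1 < k) (fun v hv => (mem_filter.1 hv).2)
    (fun u hu v hv huv => adj_of_small_blue_degree hG hRG hR hdeg huv (mem_filter.1 hu).2
      (mem_filter.1 hv).2)
  have hblue : Fintype.card V * (k - 1) = ∑ v, degIn (G \ R) univ v +
      ∑ v ∈ univ.filter (fun v => degIn (G \ R) univ v + 1 < k),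
        (k - 1 - degIn (G \ R) univ v) := by
    rw [sum_filter, ← sum_add_distrib, ← card_univ, ← smul_eq_mul, ← sum_const]
    refine sum_congr rfl fun v _ => ?_
    have := hdeg v
    split_ifs <;> omega
  have htot : ∑ v, degIn R univ v + ∑ v, degIn (G \ R) univ v = 2 * G.edgeSet.ncard := by
    rw [← sum_degIn_univ, ← sum_add_distrib]
    exact sum_congr rfl fun v _ => degIn_add_sdiff hRG _ v
  have hmain : 3 * Fintype.card V + Fintype.card V * (k - 1) ≤
      2 * G.edgeSet.ncard + 6 + (k - 1) * (k + Nat.sqrt (k - 2)) := by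
    rcases hk.eq_or_lt with rfl | hk3
    -- For k = 2 the maximum is 3 instead of the desired 2. The resulting 4n ≤ 2e(G) + 9 improves by
    -- parity.
    · norm_num at hdef hblue ⊢
      omega
    · have : k + Nat.sqrt (k - 2) + 1 ≤ (k - 1) * (k + Nat.sqrt (k - 2)) := by
        have := Nat.mul_le_mul_right (k + Nat.sqrt (k - 2)) (show 2 ≤ k - 1 by omega)
        omega
      rw [max_eq_left this] at hdef
      omega
  have hreal : (3 : ℝ) * Fintype.card V + Fintype.card V * ((k : ℝ) - 1) ≤
      2 * G.edgeSet.ncard + 6 + ((k : ℝ) - 1) * (k + Nat.sqrt (k - 2)) := by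
    have h1 : ((k - 1 : ℕ) : ℝ) = (k : ℝ) - 1 := by
      rw [Nat.cast_sub (by omega), Nat.cast_one]
    rw [← h1]
    exact_mod_cast hmain
  rw [edgeLowerBound]
  linarith

end LowerBound

/-! ### Rigidity of critical colorings around two hubs -/

section Hubs

open Finset
open scoped Classical

variable {V : Type*} [Fintype V]

/-- If two vertices `x`, `y` have `2 k - 1` common neighbours then a critical coloring uses up
their blue degrees on these. -/
theorem hub_structure {k : ℕ} {G R : SimpleGraph V} (hR : FourCycleFree R)
    (hblue : ∀ v, degIn (G \ R) univ v < k) {x y : V} (hxy : x ≠ y) {C : Finset V}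
    (hC : ∀ w ∈ C, G.Adj x w ∧ G.Adj y w) (hcard : #C + 1 = 2 * k) :
    (∀ w, G.Adj x w → w ∉ C → R.Adj x w) ∧ (∀ w, G.Adj y w → w ∉ C → R.Adj y w) ∧
      (∀ w, R.Adj x w → R.Adj y w → w ∈ C) ∧
      ∀ w, (G.Adj x w ∨ G.Adj y w) → R.Adj x w ∨ R.Adj y w := by
  let S : Finset V := {w | (G \ R).Adj x w}
  let S' : Finset V := {w | (G \ R).Adj y w}
  let T : Finset V := {w | R.Adj x w ∧ R.Adj y w}
  have hS : #S < k := by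
    have := hblue x
    unfold degIn at this
    convert this
  have hS' : #S' < k := by
    have := hblue y
    unfold degIn at this
    convert this
  have hT : #T ≤ 1 := by
    rw [card_le_one]
    intro a ha b hb
    simp only [T, mem_filter, mem_univ, true_and] at ha hb
    exact hR ha.1 ha.2 hb.1 hb.2 hxy
  -- The three sets have sizes at most k - 1, k - 1 and 1, while C has 2k - 1 elements: equality
  -- holds throughout and the union is disjoint.
  have hsub : C ⊆ S ∪ S' ∪ T := by
    intro w hw
    have := hC w hw
    simp only [S, S', T, mem_union, mem_filter, mem_univ, true_and, SimpleGraph.sdiff_adj]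
    tauto
  have h1 := card_le_card hsub
  have h2 := card_union_le (S ∪ S') T
  have h3 := card_union_add_card_inter S S'
  have hinter : #(S ∩ S') = 0 := by omega
  have heq : C = S ∪ S' ∪ T := eq_of_subset_of_card_le hsub (by omega)
  have hmem : ∀ w, w ∈ C ↔ w ∈ S ∪ S' ∪ T := fun w => by rw [← heq]
  have hdisj : ∀ w, w ∉ S ∩ S' := fun w hw => by
    rw [card_eq_zero.1 hinter] at hw
    exact notMem_empty w hw
  simp only [S, S', T, mem_union, mem_inter, mem_filter, mem_univ, true_and,
    SimpleGraph.sdiff_adj] at hmem hdisj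
  refine ⟨fun w h1 h2 => ?_, fun w h1 h2 => ?_, fun w h1 h2 => ?_, fun w h => ?_⟩
  · have := hmem w; tauto
  · have := hmem w; tauto
  · have := hmem w; tauto
  · by_cases hw : w ∈ C
    · have := hdisj w
      have := hC w hw
      tauto
    · have := hmem w
      tauto

theorem FourCycleFree.degIn_le_two {R : SimpleGraph V} (hR : FourCycleFree R) {x y : V}
    (hxy : R.Adj x y) (hcov : ∀ w, w ≠ x → w ≠ y → R.Adj x w ∨ R.Adj y w) {w : V} (hwx : w ≠ x)
    (hwy : w ≠ y) : degIn R univ w ≤ 2 := by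
  have key : ∀ x y : V, R.Adj x y → (∀ w, w ≠ x → w ≠ y → R.Adj x w ∨ R.Adj y w) → w ≠ x →
      w ≠ y → R.Adj x w → degIn R univ w ≤ 2 := by
    intro x y hxy hcov hwx hwy hxw
    have hsub : univ.filter (R.Adj w) ⊆ {x} ∪ ({t | R.Adj x t} : Finset V).filter (R.Adj w) := by
      intro t ht
      simp only [mem_filter, mem_univ, true_and, mem_union, mem_singleton] at ht ⊢
      by_contra! hcon
      have hxt : ¬ R.Adj x t := fun h => hcon.2 h ht
      have hty : t ≠ y := fun h => hxt (h ▸ hxy)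
      -- Otherwise x, w, t, y would be a red four-cycle. So all neighbours of w but x are neighbours
      -- of x, and there is at most one.
      have hyt : R.Adj y t := (hcov t hcon.1 hty).resolve_left hxt
      exact hwy (hR hxw ht.symm hxy hyt.symm hcon.1.symm)
    have h1 := hR.degIn_inter_le_one hwx.symm {t | R.Adj x t} (fun t ht => by simpa using ht)
    calc degIn R univ w ≤ _ := card_le_card hsub
      _ ≤ _ := card_union_le _ _
      _ ≤ 2 := by
        rw [card_singleton]
        exact Nat.add_le_add_left h1 1
  rcases hcov w hwx hwy with h | h
  · exact key x y hxy hcov hwx hwy h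
  · exact key y x hxy.symm (fun w h1 h2 => (hcov w h2 h1).symm) hwy hwx h

/-- A criterion for co-criticality: two adjacent vertices that together dominate the graph and
have `2 k - 1` common neighbours. -/
theorem isCoCritical_of_hubs {k : ℕ} {G : SimpleGraph V} {x y : V} (hxy : G.Adj x y)
    (hcov : ∀ w, w ≠ x → w ≠ y → G.Adj x w ∨ G.Adj y w)
    (hcommon : #{w | G.Adj x w ∧ G.Adj y w} + 1 = 2 * k)
    (hdeg : ∀ u v, u ≠ v → ¬ G.Adj u v → u ≠ x → u ≠ y → v ≠ x → v ≠ y →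
      k + 1 ≤ degIn G univ u ∨ k + 1 ≤ degIn G univ v)
    (hcrit : HasCriticalColoring fourCycle (starGraphK k) G) (htop : G ≠ ⊤) :
    IsCoCritical fourCycle (starGraphK k) G := by
  refine ⟨htop, hcrit, fun u v huv hcol => ?_⟩
  obtain ⟨R, hRG, hR, hblue⟩ := hasCriticalColoring_iff.1 hcol
  rw [SimpleGraph.compl_adj] at huv
  obtain ⟨hne, hnadj⟩ := huv
  set G' := G ⊔ SimpleGraph.edge u v with hG'
  have hGG' : G ≤ G' := le_sup_left
  have huv' : G'.Adj u v := by simp [hG', SimpleGraph.edge_adj, hne]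
  clear_value G'
  obtain ⟨hx, hy, hred, hcov'⟩ := hub_structure hR hblue hxy.ne
    (C := {w | G.Adj x w ∧ G.Adj y w})
    (fun w hw => ⟨hGG' (mem_filter.1 hw).2.1, hGG' (mem_filter.1 hw).2.2⟩) hcommon
  have hRxy : R.Adj x y := hx y (hGG' hxy) (by simp)
  -- A new edge at a hub would create a common neighbour outside C, red to both hubs, which `hred`
  -- forbids. Hence the added edge avoids the hubs.
  have hcomm : ∀ w, G'.Adj x w → G'.Adj y w → G.Adj x w ∧ G.Adj y w := by
    intro w h1 h2
    by_contra hw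
    have hw' : w ∉ ({w | G.Adj x w ∧ G.Adj y w} : Finset V) := by simpa using hw
    exact hw' (hred w (hx w h1 hw') (hy w h2 hw'))
  have hhub : ∀ w, w ≠ x → w ≠ y → G'.Adj x w → G.Adj x w := by
    intro w hwx hwy h
    exact (hcov w hwx hwy).elim id fun h' => (hcomm w h (hGG' h')).1
  have hhub' : ∀ w, w ≠ x → w ≠ y → G'.Adj y w → G.Adj y w := by
    intro w hwx hwy h
    exact (hcov w hwx hwy).elim (fun h' => (hcomm w (hGG' h') h).2) id
  have key : ∀ p q, G'.Adj p q → ¬ G.Adj p q → p ≠ x ∧ p ≠ y := by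
    rintro p q h hn
    refine ⟨?_, ?_⟩
    · rintro rfl
      exact hn (hhub q h.ne' (fun e => hn (e ▸ hxy)) h)
    · rintro rfl
      exact hn (hhub' q (fun e => hn (e ▸ hxy.symm)) h.ne' h)
  have hu := key u v huv' hnadj
  have hv := key v u huv'.symm (fun h => hnadj h.symm)
  have hcovR : ∀ w, w ≠ x → w ≠ y → R.Adj x w ∨ R.Adj y w := fun w h1 h2 =>
    hcov' w ((hcov w h1 h2).imp (fun h => hGG' h) (fun h => hGG' h))
  have hfin : ∀ p q, G'.Adj p q → ¬ G.Adj p q → p ≠ x → p ≠ y → ¬ k + 1 ≤ degIn G univ p := by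
    intro p q h hn hpx hpy hk
    have h1 := hR.degIn_le_two hRxy hcovR hpx hpy
    have h2 := hblue p
    have h3 := degIn_add_sdiff hRG univ p
    have h4 : degIn G univ p < degIn G' univ p := by
      unfold degIn
      refine card_lt_card ⟨fun w hw => ?_, fun hsub => hn ?_⟩
      · exact mem_filter.2 ⟨mem_univ _, hGG' (mem_filter.1 hw).2⟩
      · exact (mem_filter.1 (hsub (mem_filter.2 ⟨mem_univ q, h⟩))).2
    -- In `G'` the vertex p has degree at least k + 2, but red degree at most 2 and blue degree at
    -- most k - 1.
    omega
  rcases hdeg u v hne hnadj hu.1 hu.2 hv.1 hv.2 with h | h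
  · exact hfin u v huv' hnadj hu.1 hu.2 h
  · exact hfin v u huv'.symm (fun h => hnadj h.symm) hv.1 hv.2 h

end Hubs

/-! ### The explicit hub graph -/

section Construction

open Finset
open scoped Classical

/-- Two hubs, a clique of `m + 1` special vertices and two classes of `h` regular vertices. -/
abbrev HubVertex (m h : ℕ) := Bool ⊕ Fin (m + 1) ⊕ Bool × Fin h

/-- The red graph: `Sum.inl false` and `Sum.inl true` are the hubs, each regular vertex is joined
to the hub given by the parity of its index and to the regular vertex with the same index. -/
def hubRed (m h : ℕ) : SimpleGraph (HubVertex m h) where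
  Adj
    | .inl b, .inl b' => b ≠ b'
    | .inl b, .inr (.inl i) => i = 0 ∨ b = false
    | .inr (.inl i), .inl b => i = 0 ∨ b = false
    | .inl b, .inr (.inr (_, i)) => (Odd i.val ↔ b = true)
    | .inr (.inr (_, i)), .inl b => (Odd i.val ↔ b = true)
    | .inr (.inr (s, i)), .inr (.inr (t, j)) => s ≠ t ∧ i = j
    | _, _ => False
  symm.symm := by
    rintro (b | i | ⟨s, i⟩) (b' | j | ⟨t, j⟩) <;> simp +contextual [eq_comm]
  loopless.irrefl := by
    rintro (b | i | ⟨s, i⟩) <;> simp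

/-- The regular vertices that are joined to both hubs. -/
def InCore (k : ℕ) {h : ℕ} : Bool → Fin h → Prop
  | false, i => i.val + 1 < k
  | true, i => 1 ≤ i.val ∧ i.val < k

/-- The regular vertices joined to a special vertex, if `f` holds. -/
def IsAttached {h : ℕ} : Bool → Fin h → Prop
  | false, i => i.val = 0
  | true, i => i.val = 2

/-- The blue edges between the two classes of regular vertices. -/
def BlueCross (k : ℕ) (f : Prop) {h : ℕ} (i j : Fin h) : Prop :=
  (1 ≤ (j - i).val ∧ (j - i).val < k) ∧ ¬ (j.val = i.val + 1 ∧ i.val + 1 < k) ∧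
    ¬ (f ∧ i.val = 0 ∧ j.val = 2)

/-- The blue graph of the construction. -/
def hubBlue (k m h : ℕ) (f : Prop) : SimpleGraph (HubVertex m h) where
  Adj
    | .inl b, .inr (.inr (s, i)) => ¬ (Odd i.val ↔ b = true) ∧ InCore k s i
    | .inr (.inr (s, i)), .inl b => ¬ (Odd i.val ↔ b = true) ∧ InCore k s i
    | .inr (.inl i), .inr (.inl j) => i ≠ j
    | .inr (.inl i), .inr (.inr (s, j)) => f ∧ i.val = 1 ∧ IsAttached s j
    | .inr (.inr (s, j)), .inr (.inl i) => f ∧ i.val = 1 ∧ IsAttached s j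
    | .inr (.inr (false, i)), .inr (.inr (true, j)) => BlueCross k f i j
    | .inr (.inr (true, j)), .inr (.inr (false, i)) => BlueCross k f i j
    | _, _ => False
  symm.symm := by
    rintro (b | i | ⟨_ | _, i⟩) (b' | j | ⟨_ | _, j⟩) <;> simp +contextual [eq_comm]
  loopless.irrefl := by
    rintro (b | i | ⟨_ | _, i⟩) <;> simp

theorem sum_hubVertex {m h : ℕ} (g : HubVertex m h → ℕ) :
    ∑ v, g v = g (.inl false) + g (.inl true) + ∑ i, g (.inr (.inl i)) +
      (∑ i, g (.inr (.inr (false, i))) + ∑ i, g (.inr (.inr (true, i)))) := by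
  simp only [Fintype.sum_sum_type, Fintype.sum_prod_type, Fintype.sum_bool]
  ring

/-- The red graph consists of the triangle on the hubs and special vertex 0, a triangle at one hub
for each index, and pendant edges; every cycle is one of these triangles. -/
theorem fourCycleFree_hubRed (m h : ℕ) : FourCycleFree (hubRed m h) := by
  have hn : ∀ a b : Bool, (¬ a = b) = (a = !b) := by decide
  have hinj : ∀ a b : Bool, (!a) = (!b) → a = b := by decide
  rintro (a | a | ⟨a, a'⟩) (b | b | ⟨b, b'⟩) (c | c | ⟨c, c'⟩) (d | d | ⟨d, d'⟩) hab hcb had hcd hac <;>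
    simp only [hubRed, ne_eq, Sum.inl.injEq, Sum.inr.injEq, Prod.mk.injEq, reduceCtorEq,
      not_false_eq_true] at hab hcb had hcd hac ⊢ <;>
    first | grind | (simp only [hn] at hab hcb had hcd hac; grind)

theorem disjoint_hub (k m h : ℕ) (f : Prop) : Disjoint (hubBlue k m h f) (hubRed m h) := by
  rw [SimpleGraph.disjoint_left]
  rintro (b | i | ⟨_ | _, i⟩) (b' | j | ⟨_ | _, j⟩) <;> simp +contextual [hubBlue, hubRed, BlueCross]
  all_goals
    rintro h1 - - - rfl
    have : NeZero h := ⟨by rintro rfl; exact i.elim0⟩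
    rw [sub_self] at h1
    simp at h1

end Construction

/-! ### Blue degrees in the hub graph -/

section Degrees

open Finset
open scoped Classical

/-- The indicator of a proposition. -/
noncomputable def ind (P : Prop) : ℕ := if P then 1 else 0

theorem ind_of {P : Prop} (h : P) : ind P = 1 := if_pos h

theorem ind_not {P : Prop} (h : ¬ P) : ind P = 0 := if_neg h

@[simp] theorem ind_true : ind True = 1 := ind_of trivial

@[simp] theorem ind_false : ind False = 0 := ind_not id

theorem ind_congr {P Q : Prop} (h : P ↔ Q) : ind P = ind Q := congrArg ind (propext h)

theorem degIn_eq_sum_ind {V : Type*} (R : SimpleGraph V) (T : Finset V) (v : V) :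
    degIn R T v = ∑ w ∈ T, ind (R.Adj v w) := degIn_eq_sum R T v

theorem sum_fin_ind_eq {h : ℕ} (c : ℕ) (Q : Prop) :
    ∑ j : Fin h, ind (j.val = c ∧ Q) = ind (c < h ∧ Q) := by
  rw [Fin.sum_univ_eq_sum_range (fun j => ind (j = c ∧ Q)) h]
  by_cases hQ : Q <;> simp [hQ, ind]

theorem sum_fin_interval {h k : ℕ} (hk : k ≤ h) :
    ∑ t : Fin h, ind (1 ≤ t.val ∧ t.val < k) = k - 1 := by
  rw [Fin.sum_univ_eq_sum_range (fun t => ind (1 ≤ t ∧ t < k)) h]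
  rw [← sum_subset (show Ico 1 k ⊆ range h from fun t ht => ?_)]
  · rw [sum_congr rfl fun t ht => ind_of (mem_Ico.1 ht)]
    simp
  · intro t _ ht
    exact ind_not fun h' => ht (mem_Ico.2 h')
  · rw [mem_Ico] at ht
    rw [mem_range]
    omega

theorem sum_fin_cyclic_right {h k : ℕ} (hk : k ≤ h) (i : Fin h) :
    ∑ j : Fin h, ind (1 ≤ (j - i).val ∧ (j - i).val < k) = k - 1 := by
  have : NeZero h := ⟨by rintro rfl; exact i.elim0⟩
  rw [← sum_fin_interval hk]
  exact Equiv.sum_comp (Equiv.subRight i) fun t : Fin h => ind (1 ≤ t.val ∧ t.val < k)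

theorem sum_fin_cyclic_left {h k : ℕ} (hk : k ≤ h) (j : Fin h) :
    ∑ i : Fin h, ind (1 ≤ (j - i).val ∧ (j - i).val < k) = k - 1 := by
  have : NeZero h := ⟨by rintro rfl; exact j.elim0⟩
  rw [← sum_fin_interval hk]
  exact Equiv.sum_comp (Equiv.subLeft j) fun t : Fin h => ind (1 ≤ t.val ∧ t.val < k)

theorem ind_and_not_add {P Q T : Prop} (hQ : Q → P) (hT : T → P) (hQT : Q → ¬ T) :
    ind (P ∧ ¬ Q ∧ ¬ T) + ind Q + ind T = ind P := by
  by_cases hQ' : Q <;> by_cases hT' : T <;> simp_all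

/-- `BlueCross` is the circulant relation of cyclic differences 1, …, k - 1 with two disjoint sets
of pairs removed: a matching of the core vertices, making room for their blue hub edges, and, if f
holds, the pair (0, 2), making room for the edges to special vertex 1. -/
theorem blueCross_indicator {h k : ℕ} {f : Prop} (hf : f → 3 ≤ k) (i j : Fin h) :
    ind (BlueCross k f i j) + ind (j.val = i.val + 1 ∧ i.val + 1 < k) +
      ind (f ∧ i.val = 0 ∧ j.val = 2) = ind (1 ≤ (j - i).val ∧ (j - i).val < k) := by
  have hsub : i.val ≤ j.val → (j - i).val = j.val - i.val := fun h => Fin.sub_val_of_le h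
  refine ind_and_not_add ?_ ?_ ?_
  · rintro ⟨h1, h2⟩
    rw [hsub (by omega)]
    omega
  · rintro ⟨h1, h2, h3⟩
    have := hf h1
    rw [hsub (by omega)]
    omega
  · rintro ⟨h1, h2⟩ ⟨h3, h4, h5⟩
    omega

theorem sum_blueCross_right {h k : ℕ} {f : Prop} (hf : f → 3 ≤ k) (hkh : k ≤ h)
    (i : Fin h) :
    ∑ j : Fin h, ind (BlueCross k f i j) + ind (i.val + 1 < k) + ind (f ∧ i.val = 0) = k - 1 := by
  rw [← sum_fin_cyclic_right hkh i, ← sum_congr rfl fun j _ => blueCross_indicator hf i j,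
    sum_add_distrib, sum_add_distrib, sum_fin_ind_eq]
  have h1 : ∀ j : Fin h, (f ∧ i.val = 0 ∧ j.val = 2) ↔ (j.val = 2 ∧ f ∧ i.val = 0) :=
    fun j => by tauto
  simp only [h1, sum_fin_ind_eq]
  have h2 : (i.val + 1 < h ∧ i.val + 1 < k) ↔ i.val + 1 < k := by omega
  have h3 : (2 < h ∧ f ∧ i.val = 0) ↔ (f ∧ i.val = 0) :=
    and_iff_right_of_imp fun h' => by have := hf h'.1; omega
  rw [h2, h3]

theorem sum_blueCross_left {h k : ℕ} {f : Prop} (hf : f → 3 ≤ k) (hkh : k ≤ h)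
    (j : Fin h) :
    ∑ i : Fin h, ind (BlueCross k f i j) + ind (1 ≤ j.val ∧ j.val < k) +
      ind (f ∧ j.val = 2) = k - 1 := by
  rw [← sum_fin_cyclic_left hkh j, ← sum_congr rfl fun i _ => blueCross_indicator hf i j,
    sum_add_distrib, sum_add_distrib]
  have h1 : ∀ i : Fin h, (f ∧ i.val = 0 ∧ j.val = 2) ↔ (i.val = 0 ∧ f ∧ j.val = 2) :=
    fun i => by tauto
  have h2 : ∀ i : Fin h, (j.val = i.val + 1 ∧ i.val + 1 < k) ↔
      (i.val = j.val - 1 ∧ 1 ≤ j.val ∧ j.val < k) := fun i => by omega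
  simp only [h1, h2, sum_fin_ind_eq]
  have := j.isLt
  have h3 : (j.val - 1 < h ∧ 1 ≤ j.val ∧ j.val < k) ↔ (1 ≤ j.val ∧ j.val < k) := by omega
  have h4 : (0 < h ∧ f ∧ j.val = 2) ↔ (f ∧ j.val = 2) := and_iff_right (by omega)
  rw [h3, h4]

/-- Among the core vertices, exactly `k - 1` belong to a prescribed hub. -/
theorem sum_core {h k : ℕ} (hkh : k ≤ h) (b : Bool) :
    ∑ i : Fin h, ind (¬ (Odd i.val ↔ b = true) ∧ InCore k false i) +
      ∑ i : Fin h, ind (¬ (Odd i.val ↔ b = true) ∧ InCore k true i) = k - 1 := by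
  simp only [InCore]
  rw [Fin.sum_univ_eq_sum_range (fun i => ind (¬ (Odd i ↔ b = true) ∧ i + 1 < k)) h,
    Fin.sum_univ_eq_sum_range (fun i => ind (¬ (Odd i ↔ b = true) ∧ 1 ≤ i ∧ i < k)) h]
  have h1 : ∑ i ∈ range h, ind (¬ (Odd i ↔ b = true) ∧ i + 1 < k) =
      ∑ i ∈ range (k - 1), ind (¬ (Odd i ↔ b = true)) := by
    rw [← sum_subset (range_mono (show k - 1 ≤ h by omega))]
    · refine sum_congr rfl fun i hi => ind_congr ?_
      have := mem_range.1 hi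
      exact and_iff_left (by omega)
    · intro i _ hi
      rw [mem_range] at hi
      exact ind_not (by omega)
  have h2 : ∑ i ∈ range h, ind (¬ (Odd i ↔ b = true) ∧ 1 ≤ i ∧ i < k) =
      ∑ i ∈ range (k - 1), ind (¬ (Odd (i + 1) ↔ b = true)) := by
    rcases Nat.eq_zero_or_pos k with rfl | hk
    · simp
    rw [← sum_subset (range_mono hkh)]
    · obtain ⟨k, rfl⟩ := Nat.exists_eq_add_of_le' hk
      rw [sum_range_succ', ind_not (by omega), add_zero]
      refine sum_congr rfl fun i hi => ind_congr ?_
      have := mem_range.1 hi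
      exact and_iff_left (by omega)
    · intro i _ hi
      rw [mem_range] at hi
      exact ind_not (by omega)
  rw [h1, h2, ← sum_add_distrib]
  conv_rhs => rw [← card_range (k - 1), card_eq_sum_ones]
  refine sum_congr rfl fun i _ => ?_
  -- The core of the second class is shifted by one index, so i and i + 1 have opposite parity and
  -- exactly one of the two indicators is 1.
  simp only [Nat.odd_add_one]
  by_cases h3 : Odd i <;> by_cases h4 : b = true <;> simp [h3, h4]

variable {k m h : ℕ} {f : Prop}

theorem degIn_hubBlue_hub (hkh : k ≤ h) (b : Bool) :
    degIn (hubBlue k m h f) univ (.inl b) = k - 1 := by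
  rw [degIn_eq_sum_ind, sum_hubVertex, ← sum_core hkh b]
  simp [hubBlue]

theorem sum_ind_ne (i : Fin (m + 1)) : ∑ j : Fin (m + 1), ind (i ≠ j) = m := by
  rw [← add_sum_erase _ _ (mem_univ i), ind_not (by simp),
    sum_congr rfl fun j hj => ind_of (ne_of_mem_erase hj).symm]
  simp

theorem degIn_hubBlue_special (hkh : k ≤ h) (hf : f → 3 ≤ k) (i : Fin (m + 1)) :
    degIn (hubBlue k m h f) univ (.inr (.inl i)) = m + 2 * ind (f ∧ i.val = 1) := by
  rw [degIn_eq_sum_ind, sum_hubVertex]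
  have h0 : ∀ j : Fin h, (f ∧ i.val = 1 ∧ j.val = 0) ↔ (j.val = 0 ∧ f ∧ i.val = 1) :=
    fun j => by tauto
  have h2 : ∀ j : Fin h, (f ∧ i.val = 1 ∧ j.val = 2) ↔ (j.val = 2 ∧ f ∧ i.val = 1) :=
    fun j => by tauto
  simp only [hubBlue, IsAttached, h0, h2, sum_fin_ind_eq, ind_false, sum_ind_ne]
  have h3 : (0 < h ∧ f ∧ i.val = 1) ↔ (f ∧ i.val = 1) :=
    and_iff_right_of_imp fun h' => by have := hf h'.1; omega
  have h4 : (2 < h ∧ f ∧ i.val = 1) ↔ (f ∧ i.val = 1) :=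
    and_iff_right_of_imp fun h' => by have := hf h'.1; omega
  rw [h3, h4]
  ring

/-- Every removed cross edge is replaced, at each of its ends, by one blue edge to a hub or to a
special vertex. -/
theorem degIn_hubBlue_regular (hkh : k ≤ h) (hf : f → 3 ≤ k ∧ 1 ≤ m) (s : Bool)
    (i : Fin h) : degIn (hubBlue k m h f) univ (.inr (.inr (s, i))) = k - 1 := by
  rw [degIn_eq_sum_ind, sum_hubVertex]
  have hf' : f → 3 ≤ k := fun h => (hf h).1
  have hhub : ∀ s, ind (¬ (Odd i.val ↔ false = true) ∧ InCore k s i) +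
      ind (¬ (Odd i.val ↔ true = true) ∧ InCore k s i) = ind (InCore k s i) := by
    intro s
    by_cases h1 : Odd i.val <;> simp [h1]
  have hsp : ∀ s, ∑ l : Fin (m + 1), ind (f ∧ l.val = 1 ∧ IsAttached s i) =
      ind (f ∧ IsAttached s i) := by
    intro s
    have h1 : ∀ l : Fin (m + 1), (f ∧ l.val = 1 ∧ IsAttached s i) ↔
        (l.val = 1 ∧ f ∧ IsAttached s i) := fun l => by tauto
    simp only [h1, sum_fin_ind_eq]
    exact ind_congr (and_iff_right_of_imp fun h' => by have := hf h'.1; omega)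
  cases s
  · have h1 := sum_blueCross_right hf' hkh i
    have h2 := hhub false
    have h3 := hsp false
    simp only [InCore, IsAttached] at h2 h3
    simp only [hubBlue, InCore, IsAttached, ind_false, sum_const_zero]
    omega
  · have h1 := sum_blueCross_left hf' hkh i
    have h2 := hhub true
    have h3 := hsp true
    simp only [InCore, IsAttached] at h2 h3
    simp only [hubBlue, InCore, IsAttached, ind_false, sum_const_zero]
    omega

end Degrees

/-! ### Co-criticality, edge counts and choice of parameters -/

section Existence

open Finset
open scoped Classical

theorem degIn_comap {V W : Type*} [Fintype V] [Fintype W] (G : SimpleGraph V) (e : W ≃ V) (w : W) :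
    degIn (G.comap e) univ w = degIn G univ (e w) := by
  rw [degIn_eq_sum_ind, degIn_eq_sum_ind, ← Equiv.sum_comp e]
  rfl

theorem HasCriticalColoring.comap {V W : Type*} [Fintype V] [Fintype W] {k : ℕ}
    {G : SimpleGraph V} (hG : HasCriticalColoring fourCycle (starGraphK k) G) (e : W ≃ V) :
    HasCriticalColoring fourCycle (starGraphK k) (G.comap e) := by
  obtain ⟨R, hRG, hR, hdeg⟩ := hasCriticalColoring_iff.1 hG
  refine hasCriticalColoring_iff.2 ⟨R.comap e, fun a b h => hRG h,
    fun a b c d h1 h2 h3 h4 hne => e.injective (hR h1 h2 h3 h4 (e.injective.ne hne)), fun w => ?_⟩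
  have : G.comap e \ R.comap e = (G \ R).comap e := rfl
  rw [this, degIn_comap]
  exact hdeg _

theorem IsCoCritical.comap {V W : Type*} [Fintype V] [Fintype W] {k : ℕ}
    {G : SimpleGraph V} (hG : IsCoCritical fourCycle (starGraphK k) G) (e : W ≃ V) :
    IsCoCritical fourCycle (starGraphK k) (G.comap e) := by
  refine ⟨fun h => hG.1 ?_, hG.2.1.comap e, fun u v huv hcol => hG.2.2 (e u) (e v) ?_ ?_⟩
  · ext a b
    have : (G.comap e).Adj (e.symm a) (e.symm b) ↔ (⊤ : SimpleGraph W).Adj (e.symm a) (e.symm b) := by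
      rw [h]
    simpa using this
  · simpa using huv
  · convert hcol.comap e.symm using 1
    ext a b
    simp [SimpleGraph.edge_adj, Equiv.symm_apply_eq, Equiv.eq_symm_apply]

theorem ncard_edgeSet_comap {V W : Type*} [Fintype V] [Fintype W] (G : SimpleGraph V)
    (e : W ≃ V) : (G.comap e).edgeSet.ncard = G.edgeSet.ncard := by
  have h : 2 * (G.comap e).edgeSet.ncard = 2 * G.edgeSet.ncard := by
    rw [← sum_degIn_univ, ← sum_degIn_univ, ← Equiv.sum_comp e]
    exact sum_congr rfl fun w _ => degIn_comap G e w
  omega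

theorem sum_ind_eq {h : ℕ} (i : Fin h) : ∑ j : Fin h, ind (i = j) = 1 := by
  rw [← add_sum_erase _ _ (mem_univ i), ind_of rfl,
    sum_congr rfl fun j hj => ind_not (ne_of_mem_erase hj).symm]
  simp

theorem sum_ind_eq' {h : ℕ} (i : Fin h) : ∑ j : Fin h, ind (j = i) = 1 := by
  simp only [← sum_ind_eq i, eq_comm]

variable {k m h : ℕ} {f : Prop}

theorem degIn_hubRed_special (i : Fin (m + 1)) :
    degIn (hubRed m h) univ (.inr (.inl i)) = 1 + ind (i = 0) := by
  rw [degIn_eq_sum_ind, sum_hubVertex]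
  simp [hubRed]

theorem degIn_hubRed_regular (s : Bool) (i : Fin h) :
    degIn (hubRed m h) univ (.inr (.inr (s, i))) = 2 := by
  rw [degIn_eq_sum_ind, sum_hubVertex]
  have h1 := sum_ind_eq i
  by_cases h2 : Odd i.val <;> cases s <;> simp [hubRed, h1, h2]

theorem sum_degIn_hubRed (m h : ℕ) :
    ∑ v, degIn (hubRed m h) univ v = 6 + 2 * m + 6 * h := by
  have h0 := sum_ind_eq' (0 : Fin (m + 1))
  have h1 : ∑ i : Fin h, ind (¬ Odd i.val) + ∑ i : Fin h, ind (Odd i.val) = h := by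
    rw [← sum_add_distrib]
    conv_rhs => rw [← Fintype.card_fin h, ← card_univ, card_eq_sum_ones]
    refine sum_congr rfl fun i _ => ?_
    by_cases h2 : Odd i.val <;> simp [h2]
  have h2 : degIn (hubRed m h) univ (.inl false) =
      1 + (m + 1) + (∑ i : Fin h, ind (¬ Odd i.val) + ∑ i : Fin h, ind (¬ Odd i.val)) := by
    rw [degIn_eq_sum_ind, sum_hubVertex]
    simp [hubRed]
  have h3 : degIn (hubRed m h) univ (.inl true) =
      1 + 1 + (∑ i : Fin h, ind (Odd i.val) + ∑ i : Fin h, ind (Odd i.val)) := by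
    rw [degIn_eq_sum_ind, sum_hubVertex]
    simp [hubRed, h0]
  rw [sum_hubVertex, h2, h3]
  simp only [degIn_hubRed_special, degIn_hubRed_regular, sum_add_distrib, h0, sum_const, card_univ,
    Fintype.card_fin, smul_eq_mul]
  omega

theorem sum_degIn_hubBlue (hkh : k ≤ h) (hf : f → 3 ≤ k ∧ 1 ≤ m) :
    ∑ v, degIn (hubBlue k m h f) univ v =
      2 * (k - 1) + ((m + 1) * m + 2 * ind f) + 2 * (h * (k - 1)) := by
  have h1 : ∑ i : Fin (m + 1), ind (f ∧ i.val = 1) = ind f := by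
    have h2 : ∀ i : Fin (m + 1), (f ∧ i.val = 1) ↔ (i.val = 1 ∧ f) := fun i => and_comm
    simp only [h2, sum_fin_ind_eq]
    exact ind_congr (and_iff_right_of_imp fun h' => by have := hf h'; omega)
  rw [sum_hubVertex, degIn_hubBlue_hub hkh, degIn_hubBlue_hub hkh]
  simp only [degIn_hubBlue_special hkh (fun h' => (hf h').1), degIn_hubBlue_regular hkh hf,
    sum_add_distrib, ← mul_sum, h1, sum_const, card_univ, Fintype.card_fin, smul_eq_mul]
  ring

theorem hub_sdiff : (hubRed m h ⊔ hubBlue k m h f) \ hubRed m h = hubBlue k m h f := by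
  rw [sup_sdiff_left_self, (disjoint_hub k m h f).sdiff_eq_left]

theorem degIn_hub (v : HubVertex m h) : degIn (hubRed m h ⊔ hubBlue k m h f) univ v =
    degIn (hubRed m h) univ v + degIn (hubBlue k m h f) univ v := by
  rw [← degIn_add_sdiff (le_sup_left : hubRed m h ≤ hubRed m h ⊔ hubBlue k m h f), hub_sdiff]

/-- The common neighbours are the 2(k - 1) core vertices and special vertex 0. -/
theorem card_common_hub (hkh : k ≤ h) (hk : 1 ≤ k) :
    #{w | (hubRed m h ⊔ hubBlue k m h f).Adj (.inl false) w ∧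
      (hubRed m h ⊔ hubBlue k m h f).Adj (.inl true) w} + 1 = 2 * k := by
  have h0 : #{w | (hubRed m h ⊔ hubBlue k m h f).Adj (.inl false) w ∧
      (hubRed m h ⊔ hubBlue k m h f).Adj (.inl true) w} =
      ∑ w, ind ((hubRed m h ⊔ hubBlue k m h f).Adj (.inl false) w ∧
      (hubRed m h ⊔ hubBlue k m h f).Adj (.inl true) w) := by
    simp only [ind]
    rw [card_filter]
    congr!
  have h1 := sum_ind_eq' (0 : Fin (m + 1))
  have h2 : ∀ (s : Bool) (i : Fin h), ((Even i.val ∨ Odd i.val ∧ InCore k s i) ∧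
      (Odd i.val ∨ Even i.val ∧ InCore k s i)) ↔ InCore k s i := fun s i => by
    rw [← Nat.not_odd_iff_even]
    tauto
  have hfalse := sum_core hkh false
  have htrue := sum_core hkh true
  have hcore : ∀ s, ∑ i : Fin h, ind (InCore k s i) =
      ∑ i : Fin h, ind (¬ (Odd i.val ↔ false = true) ∧ InCore k s i) +
      ∑ i : Fin h, ind (¬ (Odd i.val ↔ true = true) ∧ InCore k s i) := by
    intro s
    rw [← sum_add_distrib]
    refine sum_congr rfl fun i _ => ?_
    by_cases h3 : Odd i.val <;> simp [h3]
  rw [h0, sum_hubVertex]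
  simp [hubRed, hubBlue, SimpleGraph.sup_adj, h1, h2]
  have := hcore false
  have := hcore true
  omega

/-- Regular vertices have red degree 2 and blue degree k - 1. Special vertices form a clique, so a
missing edge away from the hubs has a regular end of degree k + 1. -/
theorem isCoCritical_hub (hk : 3 ≤ k) (hkh : k ≤ h) (hf : f → 1 ≤ m) (hm : m + 2 * ind f < k) :
    IsCoCritical fourCycle (starGraphK k) (hubRed m h ⊔ hubBlue k m h f) := by
  have hf' : f → 3 ≤ k ∧ 1 ≤ m := fun h' => ⟨hk, hf h'⟩
  have hreg : ∀ s i, k + 1 ≤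
      degIn (hubRed m h ⊔ hubBlue k m h f) univ (.inr (.inr (s, i))) := by
    intro s i
    rw [degIn_hub, degIn_hubRed_regular, degIn_hubBlue_regular hkh hf']
    omega
  refine isCoCritical_of_hubs (x := .inl false) (y := .inl true) ?_ ?_
    ?_ ?_ ?_ ?_
  · simp [hubRed]
  · rintro (b | i | ⟨s, i⟩) h1 h2
    · cases b <;> simp at h1 h2
    · left; simp [hubRed]
    · by_cases h3 : Odd i.val
      · right; simp [hubRed, h3]
      · left; simp [hubRed, h3]
  · convert card_common_hub (f := f) (m := m) hkh (by omega)
  · rintro (b | i | ⟨s, i⟩) (b' | j | ⟨t, j⟩) huv hn h1 h2 h3 h4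
    · cases b <;> simp at h1 h2
    · cases b <;> simp at h1 h2
    · cases b <;> simp at h1 h2
    · cases b' <;> simp at h3 h4
    · exact absurd (Or.inr fun h => huv (by rw [h])) hn
    · exact Or.inr (hreg t j)
    · exact Or.inl (hreg s i)
    · exact Or.inl (hreg s i)
    · exact Or.inl (hreg s i)
  · refine hasCriticalColoring_iff.2 ⟨_, le_sup_left, fourCycleFree_hubRed m h, ?_⟩
    rw [hub_sdiff]
    rintro (b | i | ⟨s, i⟩)
    · rw [degIn_hubBlue_hub hkh]; omega
    · rw [degIn_hubBlue_special hkh (fun h' => (hf' h').1)]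
      have : ind (f ∧ i.val = 1) ≤ ind f := by
        by_cases hf'' : f <;> by_cases h3 : i.val = 1 <;> simp [hf'', h3]
      omega
    · rw [degIn_hubBlue_regular hkh hf']; omega
  · intro htop
    have : (hubRed m h ⊔ hubBlue k m h f).Adj (.inr (.inr (false, ⟨0, by omega⟩)))
        (.inr (.inr (false, ⟨1, by omega⟩))) := by
      rw [htop]; simp
    simp [hubRed, hubBlue] at this

theorem exists_isCoCritical {n : ℕ} (f : Prop) (hk : 3 ≤ k) (hkh : k ≤ h) (hf : f → 1 ≤ m)
    (hm : m + 2 * ind f < k) (hn : n = 3 + m + 2 * h) :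
    ∃ G : SimpleGraph (Fin n), IsCoCritical fourCycle (starGraphK k) G ∧
      2 * G.edgeSet.ncard + 2 * h = 4 + 2 * m + 6 * h + 2 * k + ((m + 1) * m + 2 * ind f) +
        2 * (h * k) := by
  have hcard : Fintype.card (Fin n) = Fintype.card (HubVertex m h) := by
    simp only [Fintype.card_fin, Fintype.card_sum, Fintype.card_prod, Fintype.card_bool, hn]
    ring
  let e : Fin n ≃ HubVertex m h := Fintype.equivOfCardEq hcard
  refine ⟨_, (isCoCritical_hub hk hkh hf hm).comap e, ?_⟩
  rw [ncard_edgeSet_comap, ← sum_degIn_univ]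
  simp only [degIn_hub, sum_add_distrib]
  rw [sum_degIn_hubRed, sum_degIn_hubBlue hkh fun h' => ⟨hk, hf h'⟩]
  obtain ⟨k, rfl⟩ := Nat.exists_eq_add_of_le' (show 1 ≤ k by omega)
  simp only [Nat.add_sub_cancel]
  ring

/-- Co-critical graphs with prescribed numbers of edges. -/
theorem exists_isCoCritical_ncard (k n ε ε' : ℕ) (hk : 3 ≤ k) (hε : ε = n % 2) (hε' : ε' = k % 2)
    (hn : 3 * (k : ℤ) + 3 + (ε : ℤ) * (2 * (ε' : ℤ) - 1) ≤ (n : ℤ)) :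
    ∃ G : SimpleGraph (Fin n), IsCoCritical fourCycle (starGraphK k) G ∧
      (Odd k → (G.edgeSet.ncard : ℝ) =
        ((k : ℝ) + 2) * n / 2 - ((2 + (ε : ℝ)) * k - 4 * ε) / 2) ∧
      (Even k → (G.edgeSet.ncard : ℝ) =
        ((k : ℝ) + 2) * n / 2 - ((2 - (ε : ℝ)) * k - 2 * (1 - 2 * (ε : ℝ))) / 2) := by
  rcases Nat.mod_two_eq_zero_or_one k with hk2 | hk2 <;>
    rcases Nat.mod_two_eq_zero_or_one n with hn2 | hn2 <;>
    rw [hk2] at hε' <;> rw [hn2] at hε <;> subst hε hε' <;> norm_num at hn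
  · have hodd : ¬ Odd k := by rw [Nat.odd_iff]; omega
    obtain ⟨h, hh⟩ : ∃ h, n = 3 + 1 + 2 * h := ⟨(n - 4) / 2, by omega⟩
    -- The parity of n = 3 + m + 2h decides that of m. Taking f true exchanges one cross edge for
    -- two edges at special vertex 1, a net gain of one edge that matches the prescribed count.
    obtain ⟨G, hG, he⟩ := exists_isCoCritical (h := h) (m := 1) True hk (by omega)
      (fun _ => le_rfl) (by rw [ind_true]; omega) hh
    refine ⟨G, hG, fun h' => absurd h' hodd, fun _ => ?_⟩
    rw [ind_true] at he
    have he' := congrArg (Nat.cast : ℕ → ℝ) he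
    have hh' := congrArg (Nat.cast : ℕ → ℝ) hh
    push_cast at he' hh' ⊢
    rw [hh']
    linarith
  · have hodd : ¬ Odd k := by rw [Nat.odd_iff]; omega
    obtain ⟨h, hh⟩ : ∃ h, n = 3 + 0 + 2 * h := ⟨(n - 3) / 2, by omega⟩
    obtain ⟨G, hG, he⟩ := exists_isCoCritical (h := h) (m := 0) False hk (by omega)
      False.elim (by rw [ind_false]; omega) hh
    refine ⟨G, hG, fun h' => absurd h' hodd, fun _ => ?_⟩
    rw [ind_false] at he
    have he' := congrArg (Nat.cast : ℕ → ℝ) he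
    have hh' := congrArg (Nat.cast : ℕ → ℝ) hh
    push_cast at he' hh' ⊢
    rw [hh']
    linarith
  · have heven : ¬ Even k := by rw [Nat.even_iff]; omega
    obtain ⟨h, hh⟩ : ∃ h, n = 3 + 1 + 2 * h := ⟨(n - 4) / 2, by omega⟩
    obtain ⟨G, hG, he⟩ := exists_isCoCritical (h := h) (m := 1) False hk (by omega)
      False.elim (by rw [ind_false]; omega) hh
    refine ⟨G, hG, fun _ => ?_, fun h' => absurd h' heven⟩
    rw [ind_false] at he
    have he' := congrArg (Nat.cast : ℕ → ℝ) he
    have hh' := congrArg (Nat.cast : ℕ → ℝ) hh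
    push_cast at he' hh' ⊢
    rw [hh']
    linarith
  · have heven : ¬ Even k := by rw [Nat.even_iff]; omega
    obtain ⟨h, hh⟩ : ∃ h, n = 3 + 2 + 2 * h := ⟨(n - 5) / 2, by omega⟩
    -- For k and n both odd the prescribed count needs m = 2 rather than m = 0: twice the edge
    -- number is (k+2)n - (m+1)k - 2 + m + m² when f fails.
    obtain ⟨G, hG, he⟩ := exists_isCoCritical (h := h) (m := 2) False hk (by omega)
      False.elim (by rw [ind_false]; omega) hh
    refine ⟨G, hG, fun _ => ?_, fun h' => absurd h' heven⟩
    rw [ind_false] at he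
    have he' := congrArg (Nat.cast : ℕ → ℝ) he
    have hh' := congrArg (Nat.cast : ℕ → ℝ) hh
    push_cast at he' hh' ⊢
    rw [hh']
    linarith

end Existence

theorem theorem1p4 :
    -- the lower bound
    (∀ k n : ℕ, 2 ≤ k → k + Nat.sqrt (k - 1) + 2 ≤ n →
      ∀ (V : Type*) [Fintype V] (G : SimpleGraph V), Fintype.card V = n →
        IsCoCritical fourCycle (starGraphK k) G →
          edgeLowerBound k n ≤ (G.edgeSet.ncard : ℝ)) ∧
    -- the bound is best possible up to an additive constant depending only on `k`
    (∀ k : ℕ, 3 ≤ k → ∃ C : ℝ, ∀ n : ℕ, 3 * k + 4 ≤ n →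
      ∃ G : SimpleGraph (Fin n), IsCoCritical fourCycle (starGraphK k) G ∧
        (G.edgeSet.ncard : ℝ) ≤ edgeLowerBound k n + C) ∧
    -- co-critical graphs with exactly the stated numbers of edges
    (∀ k n ε ε' : ℕ, 3 ≤ k → ε = n % 2 → ε' = k % 2 →
      3 * (k : ℤ) + 3 + (ε : ℤ) * (2 * (ε' : ℤ) - 1) ≤ (n : ℤ) →
      ∃ G : SimpleGraph (Fin n), IsCoCritical fourCycle (starGraphK k) G ∧
        (Odd k → (G.edgeSet.ncard : ℝ) =
          ((k : ℝ) + 2) * n / 2 - ((2 + (ε : ℝ)) * k - 4 * ε) / 2) ∧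
        (Even k → (G.edgeSet.ncard : ℝ) =
          ((k : ℝ) + 2) * n / 2 - ((2 - (ε : ℝ)) * k - 2 * (1 - 2 * (ε : ℝ))) / 2)) := by
  refine ⟨?_, ?_, exists_isCoCritical_ncard⟩
  · rintro k n hk - V _ G rfl hG
    exact edgeLowerBound_le hk hG
  · intro k hk
    -- This constant cancels all but (k+2)n/2 in the lower bound, and the exact counts do not exceed
    -- (k+2)n/2.
    refine ⟨3 + ((k : ℝ) - 1) * ((k : ℝ) + Nat.sqrt (k - 2)) / 2, fun n hn => ?_⟩
    obtain ⟨G, hG, hodd, heven⟩ := exists_isCoCritical_ncard k n _ _ hk rfl rfl (by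
      rcases Nat.mod_two_eq_zero_or_one k with hk2 | hk2 <;>
        rcases Nat.mod_two_eq_zero_or_one n with hn2 | hn2 <;> rw [hk2, hn2] <;>
        norm_num <;> omega)
    refine ⟨G, hG, ?_⟩
    have hk' : (3 : ℝ) ≤ k := by exact_mod_cast hk
    rw [edgeLowerBound]
    rcases Nat.even_or_odd k with h | h
    · rw [heven h]
      rcases Nat.mod_two_eq_zero_or_one n with hn2 | hn2 <;> rw [hn2] <;> norm_num <;> linarith
    · rw [hodd h]
      rcases Nat.mod_two_eq_zero_or_one n with hn2 | hn2 <;> rw [hn2] <;> norm_num <;> linarith
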